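/- **Setting.** An *$L$-density* is a probability measure $\mathsf a$ on $[-\infty,+\infty]$ satisfying the symmetry condition $\mathsf a(-x)=e^{-x}\mathsf a(x)$ (in particular it has no mass at $-\infty$); such measures represent binary-input memoryless output-symmetric (BMS) channels, $\mathsf a$ being the law of the log-likelihood ratio when $+1$ is sent (and its reflection the law when $-1$ is sent). Its Bhattacharyya parameter is $B(\mathsf a)=\int e^{-x/2}\,\mathsf a(dx)$. Let $\lambda(x)=\sum_i\lambda_i x^{i-1}$ and $\rho(x)=\sum_i\rho_i x^{i-1}$ be degree distributions from the edge perspective: polynomials with nonnegative coefficients and $\lambda(1)=\rho(1)=1$. Let $\star$ be the convolution at variable nodes (the law of $X+Y$) and $\boxast$ the convolution at check nodes (the law of $2\,\mathrm{atanh}(\tanh(X/2)\tanh(Y/2))$), for independent $X,Y$. For a channel $\mathsf c$ the density evolution operator is $$T_{\mathsf c}(\mathsf a)=\mathsf c\star\lambda(\rho(\mathsf a)),\qquad \rho(\mathsf a)=\sum_i\rho_i\,\mathsf a^{\boxast(i-1)},\qquad \lambda(\mathsf b)=\sum_i\lambda_i\,\mathsf b^{\star(i-1)} .$$ A *fixed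 point density* for $\mathsf c$ is an $L$-density $\mathsf f$ with $T_{\mathsf c}(\mathsf f)=\mathsf f$. The *BP fixed point* for $\mathsf c$ is the weak limit, as $\ell\to\infty$, of $T_{\mathsf c}^{\ell}(\Delta_0)$, where $\Delta_0$ is the unit mass at $0$. **Lemma.** Let $\{\mathrm{BMS}(\mathtt h)\}_{\mathtt h}$, with a real parameter $\mathtt h$, be a family of BMS channels with $L$-densities $\mathsf c_{\mathtt h}$, ordered by physical degradation: for $\mathtt h_1\le\mathtt h_2$, $\mathrm{BMS}(\mathtt h_2)$ is $\mathrm{BMS}(\mathtt h_1)$ followed by a further channel. Write $B_{\mathtt h}=B(\mathsf c_{\mathtt h})$. Then: 1. For every $\mathtt h$ there is at most one fixed point density $\mathsf f_{\mathtt h}$ for $\mathsf c_{\mathtt h}$ such that $$B_{\mathtt h}\,\lambda'(1)\,\rho'\bigl(1-B(\mathsf f_{\mathtt h})^2\bigr)<1 .$$ 2. If such a density $\mathsf f_{\mathtt h}$ exists, it is the BP fixed point for $\mathsf c_{\mathtt h}$; that is, $T_{\mathsf c_{\mathtt h}}^{\ell}(\Delta_0)\to\mathsf f_{\mathtt h}$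 weakly as $\ell\to\infty$. 3. $B(\mathsf f_{\mathtt h})$ is Lipschitz continuous with respect to $B_{\mathtt h}$: for every $\delta>0$ there is a constant $C=C(\delta,\lambda,\rho)$, not depending on the channel family, such that if $\mathsf f_{\mathtt h_1}$, $\mathsf f_{\mathtt h_2}$ are fixed point densities for $\mathsf c_{\mathtt h_1}$, $\mathsf c_{\mathtt h_2}$ with $B_{\mathtt h_i}\,\lambda'(1)\,\rho'(1-B(\mathsf f_{\mathtt h_i})^2)\le 1-\delta$ for $i=1,2$, then $$|B(\mathsf f_{\mathtt h_1})-B(\mathsf f_{\mathtt h_2})|\le C\,|B_{\mathtt h_1}-B_{\mathtt h_2}| .$$ -/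

import Mathlib

open MeasureTheory ProbabilityTheory Filter Topology

noncomputable section

/-- A probability measure on the extended real line (log-likelihood ratios) obeying the symmetry
condition `a(-x) = e^{-x} a(x)`; these are exactly the `L`-densities of binary-input memoryless
output-symmetric channels. The point `x = -∞`, where `e^{-x} a(x)` has the indeterminate form
`∞ * 0`, is left out as a value of `x`; the case `x = +∞` says that `-∞` carries no mass. -/
def IsLDensity (a : ProbabilityMeasure EReal) : Prop :=
  ∀ s : Set EReal, MeasurableSet s → ⊥ ∉ s →
    (a : Measure EReal) ((fun x => -x) ⁻¹' s) = ∫⁻ x in s, EReal.exp (-x) ∂(a : Measure EReal)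

/-- The Bhattacharyya parameter `∫ e^{-x/2} a(dx)`. -/
def bhattacharyya (a : ProbabilityMeasure EReal) : ℝ :=
  (∫⁻ x, EReal.exp (-x / 2) ∂(a : Measure EReal)).toReal

/-- The unit mass at a log-likelihood ratio `x`; `x = 0` is the useless channel,
`x = +∞` the noiseless one. -/
def unitMass (x : EReal) : ProbabilityMeasure EReal :=
  ⟨Measure.dirac x, inferInstance⟩

/-- The law of `-X`, where `X` has law `a`. For a symmetric channel with `L`-density `a` it is the
law of the channel output when the input is `-1` (under input `+1` the law is `a`). -/
def reflect (a : ProbabilityMeasure EReal) : ProbabilityMeasure EReal :=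
  a.map (f := fun x => -x) continuous_neg.measurable.aemeasurable

/-- `IsDegraded b a`: the channel with `L`-density `b` is physically degraded with respect to the
channel with `L`-density `a`, i.e. it is that channel followed by a further channel `Q`. -/
def IsDegraded (b a : ProbabilityMeasure EReal) : Prop :=
  ∃ Q : Kernel EReal EReal, IsMarkovKernel Q ∧
    (b : Measure EReal) = (a : Measure EReal).bind Q ∧
    (reflect b : Measure EReal) = (reflect a : Measure EReal).bind Q

/-- A family `c h`, `h ∈ I`, of symmetric channels (given by `L`-densities) that is ordered by
physical degradation: the channel gets worse as `h` grows. -/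
structure IsDegradedFamily (I : Set ℝ) (c : ℝ → ProbabilityMeasure EReal) : Prop where
  isLDensity : ∀ h ∈ I, IsLDensity (c h)
  degraded : ∀ h₁ ∈ I, ∀ h₂ ∈ I, h₁ ≤ h₂ → IsDegraded (c h₂) (c h₁)

/-- A degree distribution from the edge perspective, `∑ i, p_i x^(i-1)`: the coefficient of `x^n`
is the fraction of edges attached to nodes of degree `n + 1`. -/
structure DegreeDistribution where
  poly : Polynomial ℝ
  coeff_nonneg : ∀ n, 0 ≤ poly.coeff n
  eval_one : poly.eval 1 = 1

/-- The mixture `∑ n, p_n g_n`. -/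
def DegreeDistribution.mix (p : DegreeDistribution) (g : ℕ → ProbabilityMeasure EReal) :
    ProbabilityMeasure EReal :=
  ⟨∑ n ∈ Finset.range (p.poly.natDegree + 1),
      ENNReal.ofReal (p.poly.coeff n) • (g n : Measure EReal), ⟨by
    have h := p.eval_one
    rw [Polynomial.eval_eq_sum_range] at h
    simp only [one_pow, mul_one] at h
    simp only [Measure.coe_finsetSum, Measure.coe_smul, Finset.sum_apply, Pi.smul_apply,
      measure_univ, smul_eq_mul, mul_one]
    rw [← ENNReal.ofReal_sum_of_nonneg (fun n _ => p.coeff_nonneg n), h, ENNReal.ofReal_one]⟩⟩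

/-- Convolution at a variable node: the law of `X + Y`, with `X`, `Y` independent. -/
def varConv (a b : ProbabilityMeasure EReal) : ProbabilityMeasure EReal :=
  (a.prod b).map (f := fun p => p.1 + p.2) (measurable_fst.add measurable_snd).aemeasurable

/-- `tanh (x / 2)` on the extended real line. -/
def tanhHalf (x : EReal) : ℝ :=
  if x = ⊤ then 1 else if x = ⊥ then -1 else Real.tanh (x.toReal / 2)

/-- The inverse of `tanhHalf` on `[-1, 1]`: `2 atanh y = log ((1 + y) / (1 - y))`, with values
`+∞` at `1` and `-∞` at `-1`. -/
def twoArtanh (y : ℝ) : EReal :=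
  ENNReal.log (ENNReal.ofReal (1 + y) / ENNReal.ofReal (1 - y))

theorem measurable_tanhHalf : Measurable tanhHalf := by
  unfold tanhHalf
  refine Measurable.ite (measurableSet_singleton _) measurable_const
    (Measurable.ite (measurableSet_singleton _) measurable_const ?_)
  simp only [Real.tanh_eq_sinh_div_cosh]
  have h : Measurable fun x : EReal => x.toReal / 2 := measurable_ereal_toReal.div_const 2
  exact (Real.continuous_sinh.measurable.comp h).div (Real.continuous_cosh.measurable.comp h)

theorem measurable_twoArtanh : Measurable twoArtanh := by
  unfold twoArtanh
  exact ENNReal.continuous_log.measurable.comp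
    ((measurable_const.add measurable_id).ennreal_ofReal.div
      (measurable_const.sub measurable_id).ennreal_ofReal)

/-- Convolution at a check node: the law of `2 atanh (tanh (X / 2) tanh (Y / 2))`, with `X`, `Y`
independent. -/
def checkConv (a b : ProbabilityMeasure EReal) : ProbabilityMeasure EReal :=
  (a.prod b).map (f := fun p => twoArtanh (tanhHalf p.1 * tanhHalf p.2))
    (measurable_twoArtanh.comp ((measurable_tanhHalf.comp measurable_fst).mul
      (measurable_tanhHalf.comp measurable_snd))).aemeasurable

/-- The `n`-fold variable-node convolution of `a` with itself. -/
def varPow (a : ProbabilityMeasure EReal) : ℕ → ProbabilityMeasure EReal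
  | 0 => unitMass 0
  | n + 1 => varConv a (varPow a n)

/-- The `n`-fold check-node convolution of `a` with itself. -/
def checkPow (a : ProbabilityMeasure EReal) : ℕ → ProbabilityMeasure EReal
  | 0 => unitMass ⊤
  | n + 1 => checkConv a (checkPow a n)

/-- The density evolution operator `a ↦ c ⋆ λ(ρ(a))` for the channel `c`, where powers are
variable-node convolutions in `λ` and check-node convolutions in `ρ`. -/
def densityEvolution (lam rho : DegreeDistribution) (c a : ProbabilityMeasure EReal) :
    ProbabilityMeasure EReal :=
  varConv c (lam.mix (varPow (rho.mix (checkPow a))))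

/-- `f` is a fixed point density of density evolution for the channel `c`. -/
structure IsFixedPointDensity (lam rho : DegreeDistribution) (c f : ProbabilityMeasure EReal) :
    Prop where
  isLDensity : IsLDensity f
  fixed : densityEvolution lam rho c f = f

/-- `f` is the BP fixed point for the channel `c`: the weak limit, as the number of iterations
grows, of density evolution started from the useless density. -/
def IsBPFixedPoint (lam rho : DegreeDistribution) (c f : ProbabilityMeasure EReal) : Prop :=
  Tendsto (fun l : ℕ => (densityEvolution lam rho c)^[l] (unitMass 0)) atTop (𝓝 f)

/-- The quantity `B(c) λ'(1) ρ'(1 - B(f)^2)`. -/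
def uniquenessFactor (lam rho : DegreeDistribution) (c f : ProbabilityMeasure EReal) : ℝ :=
  bhattacharyya c * lam.poly.derivative.eval 1 *
    rho.poly.derivative.eval (1 - bhattacharyya f ^ 2)

end

noncomputable section

/-! ### The hyperbolic tangent parametrization of the extended real line -/

/-! Put t = tanh(X/2), which lies in [-1, 1]. Symmetry says that, given |t|, the signs + and - have
conditional probabilities (1+|t|)/2 and (1-|t|)/2, so an L-density is determined by the law of |t|.
Then 1 - B is the mean of 1 - √(1 - t²), a power series in t² with positive coefficients, hence a
positive combination of the even moments of t.

Degradation is replaced by the order `ErrorLE`, comparison of Bayes errors for all priors. In its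
error form it passes through variable nodes, where a received value only updates the prior odds. In
the equivalent form ∫ max(τ, |t|) it passes through check nodes, where |t| multiplies. It also makes
every even moment monotone, since r^(2k) is, up to a constant, a positive mixture of the functions
max(τ, r).

Even moments are multiplicative at check nodes. Comparing n-th powers term by term in the series for
1 - B, with all moments at most E t² ≤ 1 - B², gives
`EvenMomentLE.bhattacharyya_densityEvolution_sub_le`: one step of density evolution multiplies the
gap B(x) - B(f) by at most the uniqueness factor at f. The iterates from Δ₀ stay worse than f, so
their B tends to B(f). Positivity of the coefficients forces every even moment to converge, symmetry
gives the odd ones, and moments on [-1, 1] determine weak limits. Thus f is the BP fixed point;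
uniqueness is uniqueness of limits, and the Lipschitz bound compares two such limits with the same
contraction. -/

theorem tanhHalf_coe (x : ℝ) :
    tanhHalf (x : EReal) = (Real.exp x - 1) / (Real.exp x + 1) := by
  have h1 : Real.exp x = Real.exp (x / 2) * Real.exp (x / 2) := by
    rw [← Real.exp_add]; ring_nf
  have h2 : Real.exp (-(x / 2)) = (Real.exp (x / 2))⁻¹ := Real.exp_neg _
  have h3 := Real.exp_pos (x / 2)
  simp only [tanhHalf, EReal.coe_ne_top, EReal.coe_ne_bot, if_false, EReal.toReal_coe]
  rw [Real.tanh_eq, h2, h1]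
  field_simp

@[simp] theorem tanhHalf_top : tanhHalf ⊤ = 1 := by simp [tanhHalf]

@[simp] theorem tanhHalf_bot : tanhHalf ⊥ = -1 := by simp [tanhHalf]

@[simp] theorem tanhHalf_zero : tanhHalf 0 = 0 := by
  rw [← EReal.coe_zero, tanhHalf_coe]; simp

theorem tanhHalf_neg (x : EReal) : tanhHalf (-x) = -tanhHalf x := by
  induction x with
  | bot => simp
  | top => simp
  | coe x =>
    rw [← EReal.coe_neg, tanhHalf_coe, tanhHalf_coe, Real.exp_neg]
    have := Real.exp_pos x
    field_simp
    ring

theorem abs_tanhHalf_le_one (x : EReal) : |tanhHalf x| ≤ 1 := by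
  induction x with
  | bot => simp
  | top => simp
  | coe x =>
    have := Real.exp_pos x
    rw [tanhHalf_coe, abs_le, le_div_iff₀ (by positivity), div_le_one (by positivity)]
    constructor <;> linarith

theorem tanhHalf_le_one (x : EReal) : tanhHalf x ≤ 1 := (abs_le.1 (abs_tanhHalf_le_one x)).2

theorem neg_one_le_tanhHalf (x : EReal) : -1 ≤ tanhHalf x := (abs_le.1 (abs_tanhHalf_le_one x)).1

/-- The truncations of 1 + y and 1 - y to [0, ∞] never vanish together, so the quotient meets no
0/0. -/
theorem continuous_twoArtanh : Continuous twoArtanh := by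
  unfold twoArtanh
  refine ENNReal.continuous_log.comp (continuous_iff_continuousAt.2 fun y => ?_)
  refine ENNReal.Tendsto.div ?_ ?_ ?_ ?_
  · exact (ENNReal.continuous_ofReal.comp (continuous_const.add continuous_id)).continuousAt
  · simp only [ne_eq, ENNReal.ofReal_eq_zero, not_le]
    by_cases h : 0 < 1 + y
    · exact Or.inl h
    · right; linarith
  · exact (ENNReal.continuous_ofReal.comp (continuous_const.sub continuous_id)).continuousAt
  · simp

@[simp] theorem twoArtanh_one : twoArtanh 1 = ⊤ := by
  simp [twoArtanh, ENNReal.div_zero]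

@[simp] theorem twoArtanh_neg_one : twoArtanh (-1) = ⊥ := by
  simp [twoArtanh]

theorem twoArtanh_of_mem_Ioo {y : ℝ} (h1 : -1 < y) (h2 : y < 1) :
    twoArtanh y = (Real.log ((1 + y) / (1 - y)) : EReal) := by
  rw [twoArtanh, ← ENNReal.ofReal_div_of_pos (by linarith),
    ENNReal.log_ofReal_of_pos (div_pos (by linarith) (by linarith))]

theorem tanhHalf_twoArtanh {y : ℝ} (hy : |y| ≤ 1) : tanhHalf (twoArtanh y) = y := by
  obtain ⟨h1, h2⟩ := abs_le.1 hy
  rcases h1.eq_or_lt with rfl | h1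
  · simp
  rcases h2.eq_or_lt with rfl | h2
  · simp
  have h3 : 0 < 1 - y := by linarith
  rw [twoArtanh_of_mem_Ioo h1 h2, tanhHalf_coe, Real.exp_log (div_pos (by linarith) h3)]
  field_simp
  ring

theorem twoArtanh_tanhHalf (x : EReal) : twoArtanh (tanhHalf x) = x := by
  induction x with
  | bot => simp
  | top => simp
  | coe x =>
    have := Real.exp_pos x
    have h1 : -1 < tanhHalf x := by
      rw [tanhHalf_coe, lt_div_iff₀ (by positivity)]; linarith
    have h2 : tanhHalf x < 1 := by
      rw [tanhHalf_coe, div_lt_one (by positivity)]; linarith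
    rw [twoArtanh_of_mem_Ioo h1 h2, tanhHalf_coe]
    congr 1
    conv_rhs => rw [← Real.log_exp x]
    congr 1
    field_simp
    ring

theorem twoArtanh_neg {y : ℝ} (hy : |y| ≤ 1) : twoArtanh (-y) = -twoArtanh y := by
  rw [← twoArtanh_tanhHalf (-twoArtanh y), tanhHalf_neg, tanhHalf_twoArtanh hy]

/-- The log-likelihood ratio `2 atanh (tanh (x / 2) tanh (y / 2))` produced by a check node. -/
def checkNode (x y : EReal) : EReal := twoArtanh (tanhHalf x * tanhHalf y)

theorem abs_tanhHalf_mul_le_one (x y : EReal) : |tanhHalf x * tanhHalf y| ≤ 1 := by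
  rw [abs_mul]
  exact mul_le_one₀ (abs_tanhHalf_le_one x) (abs_nonneg _) (abs_tanhHalf_le_one y)

theorem tanhHalf_checkNode (x y : EReal) :
    tanhHalf (checkNode x y) = tanhHalf x * tanhHalf y :=
  tanhHalf_twoArtanh (abs_tanhHalf_mul_le_one x y)

theorem checkNode_neg_left (x y : EReal) : checkNode (-x) y = -checkNode x y := by
  rw [checkNode, tanhHalf_neg, neg_mul, twoArtanh_neg (abs_tanhHalf_mul_le_one x y), checkNode]

theorem checkNode_comm (x y : EReal) : checkNode x y = checkNode y x := by
  rw [checkNode, mul_comm, checkNode]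

theorem checkNode_neg_right (x y : EReal) : checkNode x (-y) = -checkNode x y := by
  rw [checkNode_comm, checkNode_neg_left, checkNode_comm]

theorem measurable_checkNode : Measurable fun p : EReal × EReal => checkNode p.1 p.2 :=
  measurable_twoArtanh.comp ((measurable_tanhHalf.comp measurable_fst).mul
    (measurable_tanhHalf.comp measurable_snd))

/-- `1 + tanh (x / 2)`: twice the posterior probability of the input `+1`. -/
def postPlus (x : EReal) : ENNReal := ENNReal.ofReal (1 + tanhHalf x)

/-- `1 - tanh (x / 2)`: twice the posterior probability of the input `-1`. -/
def postMinus (x : EReal) : ENNReal := ENNReal.ofReal (1 - tanhHalf x)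

@[fun_prop] theorem measurable_postPlus : Measurable postPlus :=
  (measurable_const.add measurable_tanhHalf).ennreal_ofReal

@[fun_prop] theorem measurable_postMinus : Measurable postMinus :=
  (measurable_const.sub measurable_tanhHalf).ennreal_ofReal

theorem postPlus_neg (x : EReal) : postPlus (-x) = postMinus x := by
  rw [postPlus, tanhHalf_neg, postMinus, sub_eq_add_neg]

theorem postMinus_neg (x : EReal) : postMinus (-x) = postPlus x := by
  rw [postMinus, tanhHalf_neg, postPlus, sub_neg_eq_add]

theorem postPlus_add_postMinus (x : EReal) : postPlus x + postMinus x = 2 := by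
  rw [postPlus, postMinus, ← ENNReal.ofReal_add (by linarith [neg_one_le_tanhHalf x])
    (by linarith [tanhHalf_le_one x])]
  ring_nf
  simp

@[simp] theorem postPlus_bot : postPlus ⊥ = 0 := by simp [postPlus]

@[simp] theorem postMinus_top : postMinus ⊤ = 0 := by simp [postMinus]

theorem postPlus_ne_top (x : EReal) : postPlus x ≠ ⊤ := ENNReal.ofReal_ne_top

theorem postPlus_ne_zero {x : EReal} (hx : x ≠ ⊥) : postPlus x ≠ 0 := by
  induction x with
  | bot => exact absurd rfl hx
  | top => simp [postPlus]
  | coe x =>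
    have := Real.exp_pos x
    rw [postPlus, ENNReal.ofReal_ne_zero_iff, tanhHalf_coe]
    have : 1 + (Real.exp x - 1) / (Real.exp x + 1) = 2 * Real.exp x / (Real.exp x + 1) := by
      field_simp; ring
    rw [this]; positivity

/-- The point ⊥ is a true exception: there the left side is 0 * ∞ = 0 while the right side is 2. -/
theorem postPlus_mul_exp_neg {x : EReal} (hx : x ≠ ⊥) :
    postPlus x * EReal.exp (-x) = postMinus x := by
  induction x with
  | bot => exact absurd rfl hx
  | top => simp
  | coe x =>
    have := Real.exp_pos x
    rw [← EReal.coe_neg, EReal.exp_coe, postPlus, postMinus, ← ENNReal.ofReal_mul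
      (by linarith [neg_one_le_tanhHalf x]), tanhHalf_coe, Real.exp_neg]
    congr 1
    field_simp
    ring

/-! ### Symmetric densities -/

@[fun_prop] theorem measurable_neg_ereal : Measurable fun x : EReal => -x :=
  continuous_neg.measurable

@[fun_prop] theorem measurable_exp_neg_ereal : Measurable fun x : EReal => EReal.exp (-x) :=
  measurable_neg_ereal.ereal_exp

theorem IsLDensity.measure_bot {a : ProbabilityMeasure EReal} (ha : IsLDensity a) :
    (a : Measure EReal) {⊥} = 0 := by
  have h := ha {⊤} (measurableSet_singleton _) (by simp)
  have h2 : (fun x : EReal => -x) ⁻¹' {⊤} = {⊥} := by ext x; simp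
  rw [h2] at h
  simpa using h

theorem IsLDensity.ae_ne_bot {a : ProbabilityMeasure EReal} (ha : IsLDensity a) :
    ∀ᵐ x ∂(a : Measure EReal), x ≠ ⊥ := by
  rw [ae_iff]
  simpa using ha.measure_bot

/-- The defining identity concerns sets avoiding ⊥, so the two measures agree only off ⊥, whence the
condition on `f ⊥`. -/
theorem IsLDensity.lintegral_neg {a : ProbabilityMeasure EReal} (ha : IsLDensity a)
    {f : EReal → ENNReal} (hf : Measurable f) (h0 : f ⊥ = 0) :
    ∫⁻ x, f (-x) ∂(a : Measure EReal) = ∫⁻ x, f x * EReal.exp (-x) ∂(a : Measure EReal) := by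
  have key : ((a : Measure EReal).map fun x => -x).restrict {⊥}ᶜ =
      ((a : Measure EReal).withDensity fun x => EReal.exp (-x)).restrict {⊥}ᶜ := by
    ext s hs
    have hm : MeasurableSet (s ∩ {⊥}ᶜ) := hs.inter (measurableSet_singleton _).compl
    rw [Measure.restrict_apply hs, Measure.restrict_apply hs,
      Measure.map_apply measurable_neg_ereal hm, withDensity_apply _ hm]
    exact ha _ hm (by simp)
  have hind : ∀ ν : Measure EReal, ∫⁻ x, f x ∂ν = ∫⁻ x in {⊥}ᶜ, f x ∂ν := fun ν => by
    rw [← lintegral_indicator (measurableSet_singleton _).compl]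
    refine lintegral_congr fun x => ?_
    by_cases hx : x = ⊥ <;> simp [hx, h0]
  rw [← lintegral_map hf measurable_neg_ereal, hind, key, ← hind,
    lintegral_withDensity_eq_lintegral_mul _ measurable_exp_neg_ereal hf]
  simp [mul_comm]

/-- Symmetry without an exceptional point: weighting by `postMinus` makes the measure invariant
under reflection. The factor `postPlus` vanishes at ⊥, which frees `f` from any condition there. -/
theorem IsLDensity.lintegral_neg_mul_postMinus {a : ProbabilityMeasure EReal} (ha : IsLDensity a)
    {f : EReal → ENNReal} (hf : Measurable f) :
    ∫⁻ x, f (-x) * postMinus x ∂(a : Measure EReal) =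
      ∫⁻ x, f x * postMinus x ∂(a : Measure EReal) := by
  have h := ha.lintegral_neg (f := fun x => f x * postPlus x) (hf.mul measurable_postPlus)
    (by simp)
  simp only [postPlus_neg] at h
  rw [h]
  refine lintegral_congr_ae ?_
  filter_upwards [ha.ae_ne_bot] with x hx
  rw [mul_assoc, postPlus_mul_exp_neg hx]

/-- The test functions are indicators divided by `postPlus`, which is nonzero off ⊥. This criterion
is linear in `a`, hence convenient for mixtures. -/
theorem isLDensity_of_lintegral {a : ProbabilityMeasure EReal}
    (ha : ∀ f : EReal → ENNReal, Measurable f →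
      ∫⁻ x, f (-x) * postMinus x ∂(a : Measure EReal) =
        ∫⁻ x, f x * postMinus x ∂(a : Measure EReal)) : IsLDensity a := by
  intro s hs hbot
  have h := ha (s.indicator fun x => (postPlus x)⁻¹) (measurable_postPlus.inv.indicator hs)
  have h1 : ∀ x, (s.indicator (fun x => (postPlus x)⁻¹) (-x)) * postMinus x =
      ((fun x => -x) ⁻¹' s).indicator 1 x := fun x => by
    by_cases hx : -x ∈ s
    · have hne : -x ≠ ⊥ := fun h => hbot (h ▸ hx)
      rw [Set.indicator_of_mem hx, Set.indicator_of_mem (by exact hx), ← postPlus_neg,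
        ENNReal.inv_mul_cancel (postPlus_ne_zero hne) (postPlus_ne_top _)]
      rfl
    · rw [Set.indicator_of_notMem hx, Set.indicator_of_notMem (by exact hx), zero_mul]
  have h2 : ∀ x, (s.indicator (fun x => (postPlus x)⁻¹) x) * postMinus x =
      s.indicator (fun x => EReal.exp (-x)) x := fun x => by
    by_cases hx : x ∈ s
    · have hne : x ≠ ⊥ := fun h => hbot (h ▸ hx)
      rw [Set.indicator_of_mem hx, Set.indicator_of_mem hx, ← postPlus_mul_exp_neg hne,
        ← mul_assoc, ENNReal.inv_mul_cancel (postPlus_ne_zero hne) (postPlus_ne_top _), one_mul]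
    · rw [Set.indicator_of_notMem hx, Set.indicator_of_notMem hx, zero_mul]
  simp only [h1, h2] at h
  rwa [lintegral_indicator_one (measurable_neg_ereal hs), lintegral_indicator hs] at h

/-- Symmetrization of an integral against an `L`-density. -/
theorem IsLDensity.two_mul_lintegral {a : ProbabilityMeasure EReal} (ha : IsLDensity a)
    {f : EReal → ENNReal} (hf : Measurable f) :
    2 * ∫⁻ x, f x ∂(a : Measure EReal) =
      ∫⁻ x, (f x * postPlus x + f (-x) * postMinus x) ∂(a : Measure EReal) := by
  have hm : Measurable fun x => f x * postPlus x := hf.mul measurable_postPlus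
  rw [lintegral_add_left hm, ha.lintegral_neg_mul_postMinus hf, ← lintegral_add_left hm,
    ← lintegral_const_mul _ hf]
  refine lintegral_congr fun x => ?_
  rw [← mul_add, postPlus_add_postMinus, mul_comm]

/-! ### Convolutions and mixtures -/

theorem lintegral_varConv (a b : ProbabilityMeasure EReal) {f : EReal → ENNReal}
    (hf : Measurable f) :
    ∫⁻ z, f z ∂(varConv a b : Measure EReal) =
      ∫⁻ x, ∫⁻ y, f (x + y) ∂(b : Measure EReal) ∂(a : Measure EReal) := by
  have hm : Measurable fun p : EReal × EReal => p.1 + p.2 := measurable_fst.add measurable_snd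
  rw [varConv, ProbabilityMeasure.toMeasure_map, lintegral_map hf hm,
    ProbabilityMeasure.toMeasure_prod]
  exact lintegral_prod _ (hf.comp hm).aemeasurable

theorem lintegral_checkConv (a b : ProbabilityMeasure EReal) {f : EReal → ENNReal}
    (hf : Measurable f) :
    ∫⁻ z, f z ∂(checkConv a b : Measure EReal) =
      ∫⁻ x, ∫⁻ y, f (checkNode x y) ∂(b : Measure EReal) ∂(a : Measure EReal) := by
  rw [checkConv, ProbabilityMeasure.toMeasure_map]
  refine (lintegral_map hf measurable_checkNode).trans ?_
  rw [ProbabilityMeasure.toMeasure_prod]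
  exact lintegral_prod _ (hf.comp measurable_checkNode).aemeasurable

theorem lintegral_lintegral_comm (a b : ProbabilityMeasure EReal) {F : EReal → EReal → ENNReal}
    (hF : Measurable (Function.uncurry F)) :
    ∫⁻ x, ∫⁻ y, F x y ∂(b : Measure EReal) ∂(a : Measure EReal) =
      ∫⁻ y, ∫⁻ x, F x y ∂(a : Measure EReal) ∂(b : Measure EReal) :=
  lintegral_lintegral_swap hF.aemeasurable

theorem varConv_comm (a b : ProbabilityMeasure EReal) : varConv a b = varConv b a := by
  apply Subtype.ext
  refine Measure.ext_of_lintegral _ fun f hf => ?_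
  have hm : Measurable fun p : EReal × EReal => p.1 + p.2 := measurable_fst.add measurable_snd
  refine (lintegral_varConv a b hf).trans (Eq.trans ?_ (lintegral_varConv b a hf).symm)
  rw [lintegral_lintegral_comm a b (F := fun x y => f (x + y)) (hf.comp hm)]
  simp only [add_comm]

theorem checkConv_comm (a b : ProbabilityMeasure EReal) : checkConv a b = checkConv b a := by
  apply Subtype.ext
  refine Measure.ext_of_lintegral _ fun f hf => ?_
  refine (lintegral_checkConv a b hf).trans (Eq.trans ?_ (lintegral_checkConv b a hf).symm)
  rw [lintegral_lintegral_comm a b (F := fun x y => f (checkNode x y))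
    (hf.comp measurable_checkNode)]
  simp only [checkNode_comm]

theorem DegreeDistribution.coe_mix (p : DegreeDistribution) (g : ℕ → ProbabilityMeasure EReal) :
    (p.mix g : Measure EReal) = ∑ n ∈ Finset.range (p.poly.natDegree + 1),
      ENNReal.ofReal (p.poly.coeff n) • (g n : Measure EReal) := rfl

theorem DegreeDistribution.lintegral_mix (p : DegreeDistribution)
    (g : ℕ → ProbabilityMeasure EReal) (f : EReal → ENNReal) :
    ∫⁻ x, f x ∂(p.mix g : Measure EReal) = ∑ n ∈ Finset.range (p.poly.natDegree + 1),
      ENNReal.ofReal (p.poly.coeff n) * ∫⁻ x, f x ∂(g n : Measure EReal) := by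
  rw [p.coe_mix, lintegral_finsetSum_measure]
  simp only [lintegral_smul_measure, smul_eq_mul]

theorem lintegral_unitMass (x : EReal) (f : EReal → ENNReal) :
    ∫⁻ y, f y ∂(unitMass x : Measure EReal) = f x :=
  lintegral_dirac x f

/-! ### Symmetry is preserved by mixtures and by both node operations. -/

theorem isLDensity_unitMass_zero : IsLDensity (unitMass 0) :=
  isLDensity_of_lintegral fun f _ => by simp [lintegral_unitMass]

theorem isLDensity_unitMass_top : IsLDensity (unitMass ⊤) :=
  isLDensity_of_lintegral fun f _ => by simp [lintegral_unitMass]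

theorem DegreeDistribution.isLDensity_mix (p : DegreeDistribution)
    {g : ℕ → ProbabilityMeasure EReal} (hg : ∀ n, IsLDensity (g n)) : IsLDensity (p.mix g) :=
  isLDensity_of_lintegral fun f hf => by
    simp only [p.lintegral_mix, (hg _).lintegral_neg_mul_postMinus hf]

theorem EReal.neg_add_of_ne_bot {x y : EReal} (hx : x ≠ ⊥) (hy : y ≠ ⊥) : -(x + y) = -x + -y := by
  rw [EReal.neg_add (Or.inl hx) (Or.inr hy), sub_eq_add_neg]

/-- Reflecting one variable at a time produces the factors e^{-y} and e^{-x}, whose product is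
e^{-(x+y)}. Negation is not additive on pairs such as (⊤, ⊥), but ⊥ is null for both laws. -/
theorem IsLDensity.varConv {a b : ProbabilityMeasure EReal} (ha : IsLDensity a)
    (hb : IsLDensity b) : IsLDensity (varConv a b) := by
  intro s hs hbot
  set f : EReal → ENNReal := s.indicator 1 with hfdef
  have hf : Measurable f := measurable_one.indicator hs
  have hf0 : f ⊥ = 0 := Set.indicator_of_notMem hbot _
  have hadd : Measurable fun p : EReal × EReal => p.1 + p.2 := measurable_fst.add measurable_snd
  have hadd' : Measurable fun p : EReal × EReal => -p.1 + p.2 :=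
    measurable_fst.neg.add measurable_snd
  have hl : (_root_.varConv a b : Measure EReal) ((fun x => -x) ⁻¹' s) =
      ∫⁻ z, f (-z) ∂(_root_.varConv a b : Measure EReal) := by
    rw [← lintegral_indicator_one (measurable_neg_ereal hs)]
    rfl
  have hr : ∫⁻ z in s, EReal.exp (-z) ∂(_root_.varConv a b : Measure EReal) =
      ∫⁻ z, f z * EReal.exp (-z) ∂(_root_.varConv a b : Measure EReal) := by
    rw [← lintegral_indicator hs]
    refine lintegral_congr fun z => ?_
    by_cases hz : z ∈ s <;> simp [hfdef, hz]
  have hf' : Measurable fun z => f (-z) := hf.comp measurable_neg_ereal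
  have hf'' : Measurable fun z => f z * EReal.exp (-z) := hf.mul measurable_exp_neg_ereal
  rw [hl, hr, lintegral_varConv a b hf', lintegral_varConv a b hf'']
  calc ∫⁻ x, ∫⁻ y, f (-(x + y)) ∂(b : Measure EReal) ∂(a : Measure EReal)
      = ∫⁻ x, ∫⁻ y, f (-x + -y) ∂(b : Measure EReal) ∂(a : Measure EReal) := by
        refine lintegral_congr_ae ?_
        filter_upwards [ha.ae_ne_bot] with x hx
        refine lintegral_congr_ae ?_
        filter_upwards [hb.ae_ne_bot] with y hy
        rw [EReal.neg_add_of_ne_bot hx hy]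
    _ = ∫⁻ x, ∫⁻ y, f (-x + y) * EReal.exp (-y) ∂(b : Measure EReal) ∂(a : Measure EReal) := by
        refine lintegral_congr fun x => ?_
        exact hb.lintegral_neg (f := fun y => f (-x + y))
          (hf.comp (measurable_const.add measurable_id)) (by simp [hf0])
    _ = ∫⁻ y, ∫⁻ x, f (-x + y) * EReal.exp (-y) ∂(a : Measure EReal) ∂(b : Measure EReal) :=
        lintegral_lintegral_comm a b
          ((hf.comp hadd').mul (measurable_exp_neg_ereal.comp measurable_snd))
    _ = ∫⁻ y, ∫⁻ x, f (x + y) * EReal.exp (-y) * EReal.exp (-x) ∂(a : Measure EReal)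
          ∂(b : Measure EReal) := by
        refine lintegral_congr fun y => ?_
        exact ha.lintegral_neg (f := fun x => f (x + y) * EReal.exp (-y))
          ((hf.comp (measurable_id.add measurable_const)).mul measurable_const) (by simp [hf0])
    _ = ∫⁻ x, ∫⁻ y, f (x + y) * EReal.exp (-y) * EReal.exp (-x) ∂(b : Measure EReal)
          ∂(a : Measure EReal) :=
        (lintegral_lintegral_comm a b
          (F := fun x y => f (x + y) * EReal.exp (-y) * EReal.exp (-x)) (((hf.comp hadd).mul
          (measurable_exp_neg_ereal.comp measurable_snd)).mul
          (measurable_exp_neg_ereal.comp measurable_fst))).symm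
    _ = ∫⁻ x, ∫⁻ y, f (x + y) * EReal.exp (-(x + y)) ∂(b : Measure EReal)
          ∂(a : Measure EReal) := by
        refine lintegral_congr_ae ?_
        filter_upwards [ha.ae_ne_bot] with x hx
        refine lintegral_congr_ae ?_
        filter_upwards [hb.ae_ne_bot] with y hy
        rw [EReal.neg_add_of_ne_bot hx hy, EReal.exp_add, mul_assoc, mul_comm (EReal.exp (-y))]

theorem measurable_lintegral_right (b : ProbabilityMeasure EReal) {F : EReal → EReal → ENNReal}
    (hF : Measurable (Function.uncurry F)) :
    Measurable fun x => ∫⁻ y, F x y ∂(b : Measure EReal) :=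
  hF.lintegral_prod_right'

/-- Symmetrization of a double integral against `L`-densities. -/
theorem four_mul_lintegral_lintegral {a b : ProbabilityMeasure EReal} (ha : IsLDensity a)
    (hb : IsLDensity b) {F : EReal → EReal → ENNReal} (hF : Measurable (Function.uncurry F)) :
    4 * ∫⁻ x, ∫⁻ y, F x y ∂(b : Measure EReal) ∂(a : Measure EReal) =
      ∫⁻ x, ∫⁻ y, ((F x y * postPlus y + F x (-y) * postMinus y) * postPlus x +
        (F (-x) y * postPlus y + F (-x) (-y) * postMinus y) * postMinus x)
        ∂(b : Measure EReal) ∂(a : Measure EReal) := by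
  have hF' : ∀ x, Measurable (F x) := fun x => hF.comp measurable_prodMk_left
  have e1 : ∀ x, Measurable fun y => F x y * postPlus y + F x (-y) * postMinus y := fun x =>
    ((hF' x).mul measurable_postPlus).add
      (((hF' x).comp measurable_neg_ereal).mul measurable_postMinus)
  calc 4 * ∫⁻ x, ∫⁻ y, F x y ∂(b : Measure EReal) ∂(a : Measure EReal)
      = 2 * ∫⁻ x, (2 * ∫⁻ y, F x y ∂(b : Measure EReal)) ∂(a : Measure EReal) := by
        rw [lintegral_const_mul _ (measurable_lintegral_right b hF), ← mul_assoc]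
        norm_num
    _ = _ := by
        rw [ha.two_mul_lintegral ((measurable_lintegral_right b hF).const_mul _)]
        refine lintegral_congr fun x => ?_
        rw [hb.two_mul_lintegral (hF' x), hb.two_mul_lintegral (hF' (-x)),
          ← lintegral_mul_const _ (e1 x), ← lintegral_mul_const _ (e1 (-x)),
          ← lintegral_add_left ((e1 x).mul_const _)]

/-- This is (1+s)(1+t) + (1-s)(1-t) = 2(1+st): a product of two signs is + exactly when they agree.
-/
theorem postPlus_mul_add (x y : EReal) :
    postPlus x * postPlus y + postMinus x * postMinus y = 2 * postPlus (checkNode x y) := by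
  have hx := neg_one_le_tanhHalf x
  have hx' := tanhHalf_le_one x
  have hy := neg_one_le_tanhHalf y
  have hy' := tanhHalf_le_one y
  rw [show (2 : ENNReal) = ENNReal.ofReal 2 by simp]
  simp only [postPlus, postMinus, tanhHalf_checkNode]
  rw [← ENNReal.ofReal_mul (by linarith), ← ENNReal.ofReal_mul (by linarith),
    ← ENNReal.ofReal_mul (by linarith), ← ENNReal.ofReal_add (mul_nonneg (by linarith)
    (by linarith)) (mul_nonneg (by linarith) (by linarith))]
  ring_nf

theorem postMinus_mul_add (x y : EReal) :
    postPlus x * postMinus y + postMinus x * postPlus y = 2 * postMinus (checkNode x y) := by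
  have := postPlus_mul_add x (-y)
  rwa [postPlus_neg, postMinus_neg, checkNode_neg_right, postPlus_neg] at this

theorem IsLDensity.checkConv {a b : ProbabilityMeasure EReal} (ha : IsLDensity a)
    (hb : IsLDensity b) : IsLDensity (checkConv a b) := by
  -- Averaging over the four sign patterns groups the posterior weights by the sign of the output.
  -- The resulting integrand is visibly unchanged when `f` is reflected.
  have key : ∀ f : EReal → ENNReal, Measurable f →
      4 * ∫⁻ z, f z * postMinus z ∂(_root_.checkConv a b : Measure EReal) =
        ∫⁻ x, ∫⁻ y, 2 * (f (checkNode x y) + f (-checkNode x y)) *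
          (postMinus (checkNode x y) * postPlus (checkNode x y))
          ∂(b : Measure EReal) ∂(a : Measure EReal) := fun f hf => by
    have hm : Measurable fun z => f z * postMinus z := hf.mul measurable_postMinus
    rw [lintegral_checkConv a b hm, four_mul_lintegral_lintegral ha hb
      (F := fun x y => f (checkNode x y) * postMinus (checkNode x y))
      (hm.comp measurable_checkNode)]
    refine lintegral_congr fun x => lintegral_congr fun y => ?_
    simp only [checkNode_neg_left, checkNode_neg_right, neg_neg, postMinus_neg]
    have h1 := postPlus_mul_add x y
    have h2 := postMinus_mul_add x y
    calc _ = f (checkNode x y) * postMinus (checkNode x y) *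
            (postPlus x * postPlus y + postMinus x * postMinus y) +
          f (-checkNode x y) * postPlus (checkNode x y) *
            (postPlus x * postMinus y + postMinus x * postPlus y) := by ring
      _ = _ := by rw [h1, h2]; ring
  refine isLDensity_of_lintegral fun f hf => ?_
  have h1 := key f hf
  have h2 := key (fun x => f (-x)) (hf.comp measurable_neg_ereal)
  simp only [neg_neg] at h2
  have h3 := h2.trans ((lintegral_congr fun x => lintegral_congr fun y => by
    rw [add_comm (f (-checkNode x y))]).trans h1.symm)
  exact (ENNReal.mul_right_inj (by norm_num) (by norm_num)).1 h3

theorem IsLDensity.varPow {a : ProbabilityMeasure EReal} (ha : IsLDensity a) (n : ℕ) :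
    IsLDensity (varPow a n) := by
  induction n with
  | zero => exact isLDensity_unitMass_zero
  | succ n ih => exact ha.varConv ih

theorem IsLDensity.checkPow {a : ProbabilityMeasure EReal} (ha : IsLDensity a) (n : ℕ) :
    IsLDensity (checkPow a n) := by
  induction n with
  | zero => exact isLDensity_unitMass_top
  | succ n ih => exact ha.checkConv ih

theorem IsLDensity.densityEvolution (lam rho : DegreeDistribution)
    {c a : ProbabilityMeasure EReal} (hc : IsLDensity c) (ha : IsLDensity a) :
    IsLDensity (densityEvolution lam rho c a) :=
  hc.varConv (lam.isLDensity_mix (rho.isLDensity_mix ha.checkPow).varPow)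

/-! ### The power series of `1 - √(1 - X)` -/

theorem choose_half_succ (k : ℕ) :
    ((k : ℝ) + 1) * Ring.choose (1 / 2 : ℝ) (k + 1) = Ring.choose (1 / 2 : ℝ) k * (1 / 2 - k) := by
  have h := Ring.choose_smul_choose (1 / 2 : ℝ) (Nat.le_succ k)
  simpa using h

/-- These are the coefficients of 1 - √(1 - X); consecutive ones have the positive ratio (k +
1/2)/(k + 2). -/
theorem choose_half_sign (k : ℕ) : 0 < (-1) ^ k * Ring.choose (1 / 2 : ℝ) (k + 1) := by
  induction k with
  | zero => norm_num [Ring.choose_one_right]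
  | succ k ih =>
    have h := choose_half_succ (k + 1)
    push_cast at h
    have h2 : Ring.choose (1 / 2 : ℝ) (k + 1 + 1) =
        Ring.choose (1 / 2 : ℝ) (k + 1) * (1 / 2 - (k + 1)) / (k + 1 + 1) := by
      field_simp
      linarith
    rw [h2, show (-1 : ℝ) ^ (k + 1) * (Ring.choose (1 / 2 : ℝ) (k + 1) * (1 / 2 - (k + 1)) /
      (k + 1 + 1)) = ((-1) ^ k * Ring.choose (1 / 2 : ℝ) (k + 1)) *
        (((k : ℝ) + 1 / 2) / (k + 1 + 1)) by ring]
    positivity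

theorem hasSum_one_sub_sqrt_of_lt_one {X : ℝ} (h0 : 0 ≤ X) (h1 : X < 1) :
    HasSum (fun k : ℕ => (-1) ^ k * Ring.choose (1 / 2 : ℝ) (k + 1) * X ^ (k + 1))
      (1 - √(1 - X)) := by
  have h := (Real.one_add_rpow_hasFPowerSeriesOnBall_zero (a := 1 / 2)).hasSum (y := -X)
    (by simpa [Real.enorm_eq_ofReal_abs, abs_of_nonneg h0] using h1)
  have h2 := (hasSum_nat_add_iff' 1).2 h
  simp only [binomialSeries_apply, List.ofFn_const, List.prod_replicate, Finset.sum_range_one,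
    Ring.choose_zero_right, pow_zero, smul_eq_mul, mul_one,
    ← sub_eq_add_neg, ← Real.sqrt_eq_rpow] at h2
  have h3 := h2.neg
  rw [neg_sub, zero_sub, ← sub_eq_add_neg] at h3
  have h4 : (fun k : ℕ => (-1) ^ k * Ring.choose (1 / 2 : ℝ) (k + 1) * X ^ (k + 1)) =
      fun k => -(Ring.choose (1 / 2 : ℝ) (k + 1) * (-X) ^ (k + 1)) := by
    funext k
    rw [neg_pow X]
    ring
  rw [h4]
  exact h3

/-- The endpoint X = 1, reached when |tanh| = 1, follows from X < 1 by monotonicity: letting X → 1⁻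
bounds the partial sums by 1 and the whole sum below by 1. It also makes `c` summable, which later
supplies domination. -/
theorem exists_hasSum_one_sub_sqrt : ∃ c : ℕ → ℝ, (∀ k, 0 < c k) ∧
    ∀ X : ℝ, 0 ≤ X → X ≤ 1 → HasSum (fun k => c k * X ^ (k + 1)) (1 - √(1 - X)) := by
  refine ⟨fun k => (-1) ^ k * Ring.choose (1 / 2 : ℝ) (k + 1), choose_half_sign, ?_⟩
  set c : ℕ → ℝ := fun k => (-1) ^ k * Ring.choose (1 / 2 : ℝ) (k + 1)
  have hc : ∀ k, 0 ≤ c k := fun k => (choose_half_sign k).le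
  have hlt : ∀ X : ℝ, 0 ≤ X → X < 1 → HasSum (fun k => c k * X ^ (k + 1)) (1 - √(1 - X)) :=
    fun X h0 h1 => hasSum_one_sub_sqrt_of_lt_one h0 h1
  intro X h0 h1
  rcases h1.lt_or_eq with h1 | rfl
  · exact hlt X h0 h1
  have hnear : ∀ᶠ X : ℝ in 𝓝[<] 1, 0 ≤ X ∧ X < 1 := by
    filter_upwards [Ioo_mem_nhdsLT (zero_lt_one' ℝ)] with X hX
    exact ⟨hX.1.le, hX.2⟩
  have hpart : ∀ N, ∑ k ∈ Finset.range N, c k ≤ 1 := fun N => by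
    have hcont : Continuous fun X : ℝ => ∑ k ∈ Finset.range N, c k * X ^ (k + 1) := by fun_prop
    have ht := (hcont.tendsto 1).mono_left (nhdsWithin_le_nhds (s := Set.Iio 1))
    simp only [one_pow, mul_one] at ht
    refine le_of_tendsto ht ?_
    filter_upwards [hnear] with X hX
    have := sum_le_hasSum (Finset.range N) (fun k _ => mul_nonneg (hc k) (pow_nonneg hX.1 _))
      (hlt X hX.1 hX.2)
    linarith [Real.sqrt_nonneg (1 - X)]
  have hsum : Summable c := summable_of_sum_range_le hc hpart
  have hle : ∑' k, c k ≤ 1 := Real.tsum_le_of_sum_range_le hc hpart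
  have hge : 1 ≤ ∑' k, c k := by
    have hcont : Continuous fun X : ℝ => 1 - √(1 - X) := by fun_prop
    have ht := (hcont.tendsto 1).mono_left (nhdsWithin_le_nhds (s := Set.Iio 1))
    simp only [sub_self, Real.sqrt_zero, sub_zero] at ht
    refine le_of_tendsto ht ?_
    filter_upwards [hnear] with X hX
    refine hasSum_le (fun k => ?_) (hlt X hX.1 hX.2) hsum.hasSum
    exact mul_le_of_le_one_right (hc k) (pow_le_one₀ hX.1 hX.2.le)
  simpa [le_antisymm hle hge] using hsum.hasSum

/-! ### Elementary estimates -/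

theorem pow_sub_pow_le {x y : ℝ} (hy : 0 ≤ y) (hxy : y ≤ x) (n : ℕ) :
    x ^ n - y ^ n ≤ n * x ^ (n - 1) * (x - y) := by
  have hx := hy.trans hxy
  induction n with
  | zero => simp
  | succ n ih =>
    have h1 : y ^ n ≤ x ^ n := pow_le_pow_left₀ hy hxy n
    have h2 : x * (x ^ n - y ^ n) ≤ x * (n * x ^ (n - 1) * (x - y)) :=
      mul_le_mul_of_nonneg_left ih hx
    have h3 : x * (n * x ^ (n - 1) * (x - y)) = n * x ^ n * (x - y) := by
      cases n with
      | zero => simp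
      | succ n => simp only [Nat.add_sub_cancel]; ring
    have h4 : (x - y) * y ^ n ≤ (x - y) * x ^ n := mul_le_mul_of_nonneg_left h1 (by linarith)
    rw [h3] at h2
    push_cast
    calc x ^ (n + 1) - y ^ (n + 1) = x * (x ^ n - y ^ n) + (x - y) * y ^ n := by ring
      _ ≤ n * x ^ n * (x - y) + (x - y) * x ^ n := add_le_add h2 h4
      _ = _ := by ring

theorem DegreeDistribution.eval_derivative (p : DegreeDistribution) (x : ℝ) :
    p.poly.derivative.eval x = ∑ n ∈ Finset.range (p.poly.natDegree + 1),
      p.poly.coeff n * (n * x ^ (n - 1)) := by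
  rw [Polynomial.derivative_eval, Polynomial.sum_over_range _ (by simp)]
  exact Finset.sum_congr rfl fun n _ => mul_assoc _ _ _

theorem DegreeDistribution.eval_derivative_nonneg (p : DegreeDistribution) {x : ℝ} (hx : 0 ≤ x) :
    0 ≤ p.poly.derivative.eval x := by
  rw [p.eval_derivative]
  exact Finset.sum_nonneg fun n _ => mul_nonneg (p.coeff_nonneg n) (by positivity)

theorem DegreeDistribution.eval_le_one (p : DegreeDistribution) {x : ℝ} (hx : 0 ≤ x)
    (hx1 : x ≤ 1) : p.poly.eval x ≤ 1 := by
  rw [← p.eval_one, Polynomial.eval_eq_sum_range, Polynomial.eval_eq_sum_range]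
  refine Finset.sum_le_sum fun n _ => mul_le_mul_of_nonneg_left ?_ (p.coeff_nonneg n)
  rw [one_pow]
  exact pow_le_one₀ hx hx1

theorem DegreeDistribution.eval_sub_le (p : DegreeDistribution) {x y : ℝ} (hy : 0 ≤ y)
    (hxy : y ≤ x) (hx : x ≤ 1) :
    p.poly.eval x - p.poly.eval y ≤ p.poly.derivative.eval 1 * (x - y) := by
  rw [p.eval_derivative, Polynomial.eval_eq_sum_range, Polynomial.eval_eq_sum_range,
    ← Finset.sum_sub_distrib, Finset.sum_mul]
  refine Finset.sum_le_sum fun n _ => ?_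
  rw [← mul_sub, mul_assoc]
  refine mul_le_mul_of_nonneg_left ((pow_sub_pow_le hy hxy n).trans ?_) (p.coeff_nonneg n)
  have : x ^ (n - 1) ≤ 1 := pow_le_one₀ (hy.trans hxy) hx
  rw [one_pow]
  gcongr

/-- Use min(a, b) = (a + b - |a - b|)/2 and |u + v| + |u - v| = 2 max(|u|, |v|). The threshold is
|tanh(½ log θ)| when θ > 0, the prior odds in the tanh scale. -/
theorem min_add_min_eq_max {θ t : ℝ} (hθ : 0 ≤ θ) (ht : |t| ≤ 1) :
    min (1 + t) (θ * (1 - t)) + min (1 - t) (θ * (1 + t)) =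
      (θ + 1) * (1 - max (|θ - 1| / (θ + 1)) |t|) := by
  have h1 : 0 < θ + 1 := by linarith
  have h2 : (θ + 1) * max (|θ - 1| / (θ + 1)) |t| = max |θ - 1| ((θ + 1) * |t|) := by
    rw [mul_max_of_nonneg _ _ h1.le]
    congr 1
    field_simp
  rw [mul_sub (θ + 1), h2]
  have h3 : 0 ≤ θ * |t| := by positivity
  have h4 : 0 ≤ θ * (1 - |t|) := mul_nonneg hθ (by linarith)
  rcases abs_cases t with ⟨ht1, ht2⟩ | ⟨ht1, ht2⟩ <;>
  rcases abs_cases (θ - 1) with ⟨hs1, hs2⟩ | ⟨hs1, hs2⟩ <;>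
  rw [hs1] <;> rw [ht1] at h3 h4 ⊢ <;>
  rcases min_cases (1 + t) (θ * (1 - t)) with ⟨h5, h6⟩ | ⟨h5, h6⟩ <;>
  rcases min_cases (1 - t) (θ * (1 + t)) with ⟨h7, h8⟩ | ⟨h7, h8⟩ <;>
  rw [h5, h7] <;>
  first
  | rw [max_eq_left (by linarith)]; linarith
  | rw [max_eq_right (by linarith)]; linarith

/-! ### The order by degradation -/

/-- `∫ min(1, θ e^{-x}) a(dx)`: up to normalization, the error probability of the optimal decision
about the input of the channel when the prior odds for `-1` are `θ`. -/
def errorProfile (a : ProbabilityMeasure EReal) (θ : ENNReal) : ENNReal :=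
  ∫⁻ x, min 1 (θ * EReal.exp (-x)) ∂(a : Measure EReal)

/-- The channel `b` is at most as good as the channel `a` for every decision problem about the
input. -/
def ErrorLE (a b : ProbabilityMeasure EReal) : Prop :=
  ∀ θ : ENNReal, θ ≠ ⊤ → errorProfile a θ ≤ errorProfile b θ

/-- `∫ max(τ, |tanh (x / 2)|) a(dx)`. -/
def foldProfile (a : ProbabilityMeasure EReal) (τ : ℝ) : ENNReal :=
  ∫⁻ x, ENNReal.ofReal (max τ |tanhHalf x|) ∂(a : Measure EReal)

theorem ErrorLE.refl (a : ProbabilityMeasure EReal) : ErrorLE a a := fun _ _ => le_rfl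

theorem ErrorLE.trans {a b c : ProbabilityMeasure EReal} (h : ErrorLE a b) (h' : ErrorLE b c) :
    ErrorLE a c := fun θ hθ => (h θ hθ).trans (h' θ hθ)

@[fun_prop] theorem measurable_min_one_mul_exp (θ : ENNReal) :
    Measurable fun x : EReal => min 1 (θ * EReal.exp (-x)) :=
  measurable_const.min (measurable_exp_neg_ereal.const_mul θ)

theorem measurable_foldIntegrand :
    Measurable fun p : ℝ × EReal => ENNReal.ofReal (max p.1 |tanhHalf p.2|) :=
  (measurable_fst.max (measurable_tanhHalf.comp measurable_snd).abs).ennreal_ofReal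

theorem errorProfile_le_one (a : ProbabilityMeasure EReal) (θ : ENNReal) :
    errorProfile a θ ≤ 1 := by
  calc errorProfile a θ ≤ ∫⁻ _, 1 ∂(a : Measure EReal) :=
        lintegral_mono fun x => min_le_left _ _
    _ = 1 := by simp

theorem foldProfile_ne_top (a : ProbabilityMeasure EReal) (τ : ℝ) : foldProfile a τ ≠ ⊤ := by
  refine ne_top_of_le_ne_top (b := ENNReal.ofReal (max τ 1)) ENNReal.ofReal_ne_top ?_
  calc foldProfile a τ ≤ ∫⁻ _, ENNReal.ofReal (max τ 1) ∂(a : Measure EReal) :=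
        lintegral_mono fun x =>
          ENNReal.ofReal_le_ofReal (max_le_max le_rfl (abs_tanhHalf_le_one x))
    _ = _ := by simp

theorem min_mul_postPlus (θ : ENNReal) (x : EReal) :
    min 1 (θ * EReal.exp (-x)) * postPlus x = min (postPlus x) (θ * postMinus x) := by
  by_cases hx : x = ⊥
  · simp [hx]
  · rw [← postPlus_mul_exp_neg hx, min_mul_of_nonneg _ _ zero_le, one_mul]
    ring_nf

/-- Symmetrizing the Bayes error leaves a function of |tanh| only. The additive form avoids
subtraction in `ENNReal`, and shows that a larger error means a smaller fold profile. -/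
theorem two_mul_errorProfile_add {a : ProbabilityMeasure EReal} (ha : IsLDensity a) {θ : ℝ}
    (hθ : 0 ≤ θ) :
    2 * errorProfile a (ENNReal.ofReal θ) +
      ENNReal.ofReal (θ + 1) * foldProfile a (|θ - 1| / (θ + 1)) = ENNReal.ofReal (θ + 1) := by
  set τ := |θ - 1| / (θ + 1) with hτ
  have hτ1 : τ ≤ 1 := by
    rw [hτ, div_le_one (by linarith), abs_le]
    constructor <;> linarith
  have hτ0 : 0 ≤ τ := by positivity
  have hm : Measurable fun x : EReal => ENNReal.ofReal (max τ |tanhHalf x|) :=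
    measurable_foldIntegrand.comp measurable_prodMk_left
  rw [errorProfile, ha.two_mul_lintegral (measurable_min_one_mul_exp _), foldProfile,
    ← lintegral_const_mul _ hm, ← lintegral_add_right _ (hm.const_mul _)]
  have hpt : ∀ x : EReal, min 1 (ENNReal.ofReal θ * EReal.exp (-x)) * postPlus x +
      min 1 (ENNReal.ofReal θ * EReal.exp (- -x)) * postMinus x +
      ENNReal.ofReal (θ + 1) * ENNReal.ofReal (max τ |tanhHalf x|) = ENNReal.ofReal (θ + 1) := by
    intro x
    have h1 := tanhHalf_le_one x
    have h2 := neg_one_le_tanhHalf x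
    have h3 : max τ |tanhHalf x| ≤ 1 := max_le hτ1 (abs_tanhHalf_le_one x)
    rw [min_mul_postPlus, ← postPlus_neg, min_mul_postPlus, postPlus_neg, postMinus_neg]
    simp only [postPlus, postMinus]
    rw [← ENNReal.ofReal_mul hθ, ← ENNReal.ofReal_mul hθ, ← ENNReal.ofReal_min,
      ← ENNReal.ofReal_min, ← ENNReal.ofReal_add
        (le_min (by linarith) (mul_nonneg hθ (by linarith)))
        (le_min (by linarith) (mul_nonneg hθ (by linarith))),
      min_add_min_eq_max hθ (abs_tanhHalf_le_one x), ← ENNReal.ofReal_mul (by linarith),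
      ← ENNReal.ofReal_add (mul_nonneg (by linarith) (by linarith))
        (mul_nonneg (by linarith) (le_max_of_le_left hτ0))]
    congr 1
    ring
  rw [lintegral_congr hpt]
  simp

theorem le_of_add_eq_add_of_le {p q r s : ENNReal} (h : p + q = r + s) (hpr : p ≤ r)
    (hp : p ≠ ⊤) : s ≤ q := by
  by_contra! hlt
  exact absurd h (ENNReal.add_lt_add_of_le_of_lt hp hpr hlt).ne

theorem errorLE_iff_foldProfile {a b : ProbabilityMeasure EReal} (ha : IsLDensity a)
    (hb : IsLDensity b) :
    ErrorLE a b ↔ ∀ τ, 0 ≤ τ → foldProfile b τ ≤ foldProfile a τ := by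
  constructor
  · intro h τ hτ
    rcases le_or_gt 1 τ with h1 | h1
    · have : ∀ x, max τ |tanhHalf x| = τ := fun x =>
        max_eq_left ((abs_tanhHalf_le_one x).trans h1)
      simp [foldProfile, this]
    · have h2 : 0 < 1 - τ := by linarith
      -- These odds solve |θ - 1|/(θ + 1) = τ with θ ≥ 1.
      have hθ : 0 ≤ (1 + τ) / (1 - τ) := by positivity
      have hτ' : |(1 + τ) / (1 - τ) - 1| / ((1 + τ) / (1 - τ) + 1) = τ := by
        rw [show (1 + τ) / (1 - τ) - 1 = 2 * τ / (1 - τ) by field_simp; ring,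
          show (1 + τ) / (1 - τ) + 1 = 2 / (1 - τ) by field_simp; ring,
          abs_of_nonneg (by positivity)]
        field_simp
      have e1 := two_mul_errorProfile_add ha hθ
      have e2 := two_mul_errorProfile_add hb hθ
      rw [hτ'] at e1 e2
      have h3 := le_of_add_eq_add_of_le (e1.trans e2.symm)
        (mul_le_mul_right (h _ ENNReal.ofReal_ne_top) 2)
        (ENNReal.mul_ne_top (by simp) (ne_top_of_le_ne_top (by simp) (errorProfile_le_one _ _)))
      exact (ENNReal.mul_le_mul_iff_right (by simp; positivity) ENNReal.ofReal_ne_top).1 h3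
  · intro h θ hθ
    rw [← ENNReal.ofReal_toReal hθ]
    have hθ0 : 0 ≤ θ.toReal := ENNReal.toReal_nonneg
    have e1 := two_mul_errorProfile_add ha hθ0
    have e2 := two_mul_errorProfile_add hb hθ0
    rw [add_comm] at e1 e2
    have h3 := le_of_add_eq_add_of_le (e2.trans e1.symm)
      (mul_le_mul_right (h _ (by positivity)) _)
      (ENNReal.mul_ne_top (by simp) (foldProfile_ne_top _ _))
    exact (ENNReal.mul_le_mul_iff_right (by simp) (by simp)).1 h3

/-- Bayes' rule: observing x from the first channel multiplies the prior odds by e^{-x}, and the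
second channel then faces the updated odds. -/
theorem errorProfile_varConv {a b : ProbabilityMeasure EReal} (ha : IsLDensity a)
    (hb : IsLDensity b) (θ : ENNReal) :
    errorProfile (varConv a b) θ =
      ∫⁻ x, errorProfile b (θ * EReal.exp (-x)) ∂(a : Measure EReal) := by
  rw [errorProfile, lintegral_varConv a b (measurable_min_one_mul_exp θ)]
  refine lintegral_congr_ae ?_
  filter_upwards [ha.ae_ne_bot] with x hx
  refine lintegral_congr_ae ?_
  filter_upwards [hb.ae_ne_bot] with y hy
  rw [EReal.neg_add_of_ne_bot hx hy, EReal.exp_add, mul_assoc]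

theorem exp_neg_ne_top {x : EReal} (hx : x ≠ ⊥) : EReal.exp (-x) ≠ ⊤ := by
  rw [ne_eq, EReal.exp_eq_top_iff, EReal.neg_eq_top_iff]
  exact hx

theorem ErrorLE.varConv {a a' b b' : ProbabilityMeasure EReal} (ha : IsLDensity a)
    (ha' : IsLDensity a') (hb : IsLDensity b) (hb' : IsLDensity b') (h : ErrorLE a a')
    (h' : ErrorLE b b') : ErrorLE (varConv a b) (varConv a' b') := by
  have key : ∀ {a b b' : ProbabilityMeasure EReal}, IsLDensity a → IsLDensity b →
      IsLDensity b' → ErrorLE b b' → ErrorLE (_root_.varConv a b) (_root_.varConv a b') := by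
    intro a b b' ha hb hb' h θ hθ
    rw [errorProfile_varConv ha hb, errorProfile_varConv ha hb']
    refine lintegral_mono_ae ?_
    filter_upwards [ha.ae_ne_bot] with x hx
    exact h _ (ENNReal.mul_ne_top hθ (exp_neg_ne_top hx))
  refine (key ha hb hb' h').trans ?_
  rw [varConv_comm a, varConv_comm a']
  exact key hb' ha ha' h

theorem ErrorLE.checkConv {a a' b b' : ProbabilityMeasure EReal} (ha : IsLDensity a)
    (ha' : IsLDensity a') (hb : IsLDensity b) (hb' : IsLDensity b') (h : ErrorLE a a')
    (h' : ErrorLE b b') : ErrorLE (checkConv a b) (checkConv a' b') := by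
  have key : ∀ {a b b' : ProbabilityMeasure EReal}, IsLDensity a → IsLDensity b →
      IsLDensity b' → ErrorLE b b' → ErrorLE (_root_.checkConv a b) (_root_.checkConv a b') := by
    intro a b b' ha hb hb' h
    rw [errorLE_iff_foldProfile (ha.checkConv hb) (ha.checkConv hb')]
    rw [errorLE_iff_foldProfile hb hb'] at h
    intro τ hτ
    have hm : Measurable fun x : EReal => ENNReal.ofReal (max τ |tanhHalf x|) :=
      measurable_foldIntegrand.comp measurable_prodMk_left
    rw [foldProfile, foldProfile, lintegral_checkConv a b' hm, lintegral_checkConv a b hm]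
    refine lintegral_mono fun x => ?_
    simp only [tanhHalf_checkNode, abs_mul]
    rcases (abs_nonneg (tanhHalf x)).eq_or_lt with h0 | h0
    · simp [← h0]
    · have hs : ∀ y, ENNReal.ofReal (max τ (|tanhHalf x| * |tanhHalf y|)) =
          ENNReal.ofReal |tanhHalf x| *
            ENNReal.ofReal (max (τ / |tanhHalf x|) |tanhHalf y|) := fun y => by
        rw [← ENNReal.ofReal_mul h0.le, mul_max_of_nonneg _ _ h0.le, mul_div_cancel₀ _ h0.ne']
      have hm' : Measurable fun y : EReal =>
          ENNReal.ofReal (max (τ / |tanhHalf x|) |tanhHalf y|) :=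
        measurable_foldIntegrand.comp measurable_prodMk_left
      simp only [hs]
      rw [lintegral_const_mul _ hm', lintegral_const_mul _ hm']
      exact mul_le_mul_right (h _ (by positivity)) _
  refine (key ha hb hb' h').trans ?_
  rw [checkConv_comm a, checkConv_comm a']
  exact key hb' ha ha' h

theorem DegreeDistribution.errorLE_mix (p : DegreeDistribution)
    {g g' : ℕ → ProbabilityMeasure EReal} (h : ∀ n, ErrorLE (g n) (g' n)) :
    ErrorLE (p.mix g) (p.mix g') := fun θ hθ => by
  rw [errorProfile, errorProfile, p.lintegral_mix, p.lintegral_mix]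
  exact Finset.sum_le_sum fun n _ => mul_le_mul_right (h n θ hθ) _

theorem ErrorLE.varPow {a b : ProbabilityMeasure EReal} (ha : IsLDensity a) (hb : IsLDensity b)
    (h : ErrorLE a b) (n : ℕ) : ErrorLE (varPow a n) (varPow b n) := by
  induction n with
  | zero => exact ErrorLE.refl _
  | succ n ih => exact ErrorLE.varConv ha hb (ha.varPow n) (hb.varPow n) h ih

theorem ErrorLE.checkPow {a b : ProbabilityMeasure EReal} (ha : IsLDensity a)
    (hb : IsLDensity b) (h : ErrorLE a b) (n : ℕ) : ErrorLE (checkPow a n) (checkPow b n) := by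
  induction n with
  | zero => exact ErrorLE.refl _
  | succ n ih => exact ErrorLE.checkConv ha hb (ha.checkPow n) (hb.checkPow n) h ih

theorem ErrorLE.densityEvolution (lam rho : DegreeDistribution)
    {c c' a a' : ProbabilityMeasure EReal} (hc : IsLDensity c) (hc' : IsLDensity c')
    (ha : IsLDensity a) (ha' : IsLDensity a') (h : ErrorLE c c') (h' : ErrorLE a a') :
    ErrorLE (densityEvolution lam rho c a) (densityEvolution lam rho c' a') := by
  have h1 := rho.isLDensity_mix ha.checkPow
  have h2 := rho.isLDensity_mix ha'.checkPow
  exact ErrorLE.varConv hc hc' (lam.isLDensity_mix h1.varPow) (lam.isLDensity_mix h2.varPow) h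
    (lam.errorLE_mix (ErrorLE.varPow h1 h2 (rho.errorLE_mix (ErrorLE.checkPow ha ha' h'))))

theorem errorLE_unitMass_zero {a : ProbabilityMeasure EReal} (ha : IsLDensity a) :
    ErrorLE a (unitMass 0) := by
  rw [errorLE_iff_foldProfile ha isLDensity_unitMass_zero]
  intro τ hτ
  calc foldProfile (unitMass 0) τ = ∫⁻ _, ENNReal.ofReal τ ∂(a : Measure EReal) := by
        simp [foldProfile, lintegral_unitMass]
    _ ≤ foldProfile a τ :=
        lintegral_mono fun x => ENNReal.ofReal_le_ofReal (le_max_left _ _)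

/-! ### Physical degradation implies the error order. -/

theorem reflect_coe (a : ProbabilityMeasure EReal) :
    (reflect a : Measure EReal) = (a : Measure EReal).map fun x => -x := rfl

/-- No randomized test (v, w) beats the Bayes error, because min(1, θ e^{-x}) is below every convex
combination of its two arguments. -/
theorem errorProfile_le_of_test {a : ProbabilityMeasure EReal} (ha : IsLDensity a) (θ : ENNReal)
    {v w : EReal → ENNReal} (hv : Measurable v) (hw : Measurable w) (hvw : ∀ x, v x + w x = 1) :
    errorProfile a θ ≤
      ∫⁻ x, v x ∂(a : Measure EReal) + θ * ∫⁻ x, w x ∂(reflect a : Measure EReal) := by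
  have hw' : Measurable (({⊥}ᶜ : Set EReal).indicator w) :=
    hw.indicator (measurableSet_singleton _).compl
  have h1 : ∫⁻ x, w x * EReal.exp (-x) ∂(a : Measure EReal) ≤
      ∫⁻ x, w x ∂(reflect a : Measure EReal) := by
    calc ∫⁻ x, w x * EReal.exp (-x) ∂(a : Measure EReal)
        = ∫⁻ x, ({⊥}ᶜ : Set EReal).indicator w x * EReal.exp (-x) ∂(a : Measure EReal) := by
          refine lintegral_congr_ae ?_
          filter_upwards [ha.ae_ne_bot] with x hx
          rw [Set.indicator_of_mem (by simpa using hx)]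
      _ = ∫⁻ x, ({⊥}ᶜ : Set EReal).indicator w (-x) ∂(a : Measure EReal) :=
          (ha.lintegral_neg hw' (by simp)).symm
      _ ≤ ∫⁻ x, w (-x) ∂(a : Measure EReal) :=
          lintegral_mono fun x => Set.indicator_le_self _ _ _
      _ = _ := by rw [reflect_coe, lintegral_map hw measurable_neg_ereal]
  have hm : Measurable fun x => w x * EReal.exp (-x) := hw.mul measurable_exp_neg_ereal
  calc errorProfile a θ
      ≤ ∫⁻ x, (v x + θ * (w x * EReal.exp (-x))) ∂(a : Measure EReal) := by
        refine lintegral_mono fun x => ?_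
        calc min 1 (θ * EReal.exp (-x))
            = v x * min 1 (θ * EReal.exp (-x)) + w x * min 1 (θ * EReal.exp (-x)) := by
              rw [← add_mul, hvw, one_mul]
          _ ≤ v x * 1 + w x * (θ * EReal.exp (-x)) :=
              add_le_add (mul_le_mul_right (min_le_left _ _) _)
                (mul_le_mul_right (min_le_right _ _) _)
          _ = _ := by ring
    _ = ∫⁻ x, v x ∂(a : Measure EReal) + θ * ∫⁻ x, w x * EReal.exp (-x) ∂(a : Measure EReal) := by
        rw [lintegral_add_left hv, lintegral_const_mul _ hm]
    _ ≤ _ := by gcongr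

/-- The likelihood ratio test attains the Bayes error. For θ ≠ 0 its acceptance set contains ⊥, so
symmetry applies to the complement. -/
theorem exists_test_eq_errorProfile {b : ProbabilityMeasure EReal} (hb : IsLDensity b)
    {θ : ENNReal} (hθ : θ ≠ 0) : ∃ A : Set EReal, MeasurableSet A ∧
      errorProfile b θ = (b : Measure EReal) A + θ * (reflect b : Measure EReal) Aᶜ := by
  have hmeas : MeasurableSet {x : EReal | 1 ≤ θ * EReal.exp (-x)} :=
    measurableSet_le measurable_const (measurable_exp_neg_ereal.const_mul θ)
  refine ⟨{x | 1 ≤ θ * EReal.exp (-x)}, hmeas, ?_⟩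
  set A : Set EReal := {x | 1 ≤ θ * EReal.exp (-x)}
  have hbot : ⊥ ∉ Aᶜ := by simp [A, ENNReal.mul_top hθ]
  rw [reflect_coe, Measure.map_apply measurable_neg_ereal hmeas.compl, hb _ hmeas.compl hbot,
    errorProfile, ← lintegral_add_compl _ hmeas, ← lintegral_const_mul _ measurable_exp_neg_ereal]
  congr 1
  · rw [setLIntegral_congr_fun hmeas (g := fun _ => 1) fun x hx => min_eq_left hx]
    simp
  · exact setLIntegral_congr_fun hmeas.compl fun x hx =>
      min_eq_right (not_le.1 (Set.mem_compl_iff _ _ |>.1 hx)).le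

/-- Data processing: the optimal test for `b`, pulled back through the kernel, is a randomized test
for `a`. -/
theorem IsDegraded.errorLE {a b : ProbabilityMeasure EReal} (ha : IsLDensity a)
    (hb : IsLDensity b) (h : IsDegraded b a) : ErrorLE a b := by
  obtain ⟨Q, hQ, h1, h2⟩ := h
  intro θ _
  rcases eq_or_ne θ 0 with rfl | hθ
  · simp [errorProfile]
  obtain ⟨A, hA, hAeq⟩ := exists_test_eq_errorProfile hb hθ
  rw [hAeq, h1, h2, Measure.bind_apply hA Q.aemeasurable,
    Measure.bind_apply hA.compl Q.aemeasurable]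
  exact errorProfile_le_of_test ha θ (Q.measurable_coe hA) (Q.measurable_coe hA.compl)
    fun x => prob_add_prob_compl hA

/-! ### Moments -/

/-- The `n`-th moment of `tanh (X / 2)`. -/
def tanhMoment (a : ProbabilityMeasure EReal) (n : ℕ) : ℝ :=
  ∫ x, tanhHalf x ^ n ∂(a : Measure EReal)

theorem integrable_of_abs_le (a : ProbabilityMeasure EReal) {g : EReal → ℝ} (hg : Measurable g)
    {C : ℝ} (hC : ∀ x, |g x| ≤ C) : Integrable g (a : Measure EReal) :=
  Integrable.of_bound hg.aestronglyMeasurable C (Eventually.of_forall hC)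

theorem abs_tanhHalf_pow_le_one (x : EReal) (n : ℕ) : |tanhHalf x ^ n| ≤ 1 := by
  rw [abs_pow]
  exact pow_le_one₀ (abs_nonneg _) (abs_tanhHalf_le_one x)

theorem integrable_tanhHalf_pow (a : ProbabilityMeasure EReal) (n : ℕ) :
    Integrable (fun x => tanhHalf x ^ n) (a : Measure EReal) :=
  integrable_of_abs_le a (measurable_tanhHalf.pow_const n) fun x => abs_tanhHalf_pow_le_one x n

theorem tanhMoment_zero (a : ProbabilityMeasure EReal) : tanhMoment a 0 = 1 := by
  simp [tanhMoment]

theorem tanhMoment_even_le_two (a : ProbabilityMeasure EReal) (k : ℕ) :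
    tanhMoment a (2 * (k + 1)) ≤ tanhMoment a 2 :=
  integral_mono (integrable_tanhHalf_pow a _) (integrable_tanhHalf_pow a _) fun x => by
    simp only [pow_mul, pow_succ _ k]
    refine mul_le_of_le_one_left (sq_nonneg _) (pow_le_one₀ (sq_nonneg _) ?_)
    exact (sq_le_one_iff_abs_le_one _).2 (abs_tanhHalf_le_one x)

theorem tanhMoment_even_nonneg (a : ProbabilityMeasure EReal) (k : ℕ) :
    0 ≤ tanhMoment a (2 * k) :=
  integral_nonneg fun x => by rw [pow_mul]; positivity

theorem tanhMoment_even_eq_toReal (a : ProbabilityMeasure EReal) (k : ℕ) :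
    tanhMoment a (2 * k) =
      (∫⁻ x, ENNReal.ofReal (|tanhHalf x| ^ (2 * k)) ∂(a : Measure EReal)).toReal := by
  rw [tanhMoment, integral_eq_lintegral_of_nonneg_ae
    (Eventually.of_forall fun x => by simp only [pow_mul, Pi.zero_apply]; positivity)
    (measurable_tanhHalf.pow_const _).aestronglyMeasurable]
  simp only [pow_mul, sq_abs]

theorem tanhMoment_checkConv (a b : ProbabilityMeasure EReal) (n : ℕ) :
    tanhMoment (checkConv a b) n = tanhMoment a n * tanhMoment b n := by
  rw [tanhMoment, checkConv, ProbabilityMeasure.toMeasure_map]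
  refine (integral_map measurable_checkNode.aemeasurable
    (measurable_tanhHalf.pow_const n).aestronglyMeasurable).trans ?_
  simp only [tanhHalf_checkNode, mul_pow, ProbabilityMeasure.toMeasure_prod]
  exact integral_prod_mul (fun x => tanhHalf x ^ n) (fun y => tanhHalf y ^ n)

theorem tanhMoment_checkPow (a : ProbabilityMeasure EReal) (n k : ℕ) :
    tanhMoment (checkPow a k) n = tanhMoment a n ^ k := by
  induction k with
  | zero => simp [tanhMoment, checkPow, unitMass]
  | succ k ih => rw [checkPow, tanhMoment_checkConv, ih, pow_succ']

/-- The signs carry weights (1 ± t)/2, and the weighted average of ± t^{2k+1} is t^{2k+2}. The proof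
integrates 1 - t^n to remain nonnegative. -/
theorem IsLDensity.tanhMoment_odd {a : ProbabilityMeasure EReal} (ha : IsLDensity a) (k : ℕ) :
    tanhMoment a (2 * k + 1) = tanhMoment a (2 * k + 2) := by
  have hm : Measurable fun x => ENNReal.ofReal (1 - tanhHalf x ^ (2 * k + 1)) :=
    (measurable_const.sub (measurable_tanhHalf.pow_const _)).ennreal_ofReal
  have hle : ∀ x n, tanhHalf x ^ n ≤ 1 := fun x n => (abs_le.1 (abs_tanhHalf_pow_le_one x n)).2
  have hge : ∀ x n, -1 ≤ tanhHalf x ^ n := fun x n => (abs_le.1 (abs_tanhHalf_pow_le_one x n)).1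
  have hpt : ∀ x, ENNReal.ofReal (1 - tanhHalf x ^ (2 * k + 1)) * postPlus x +
      ENNReal.ofReal (1 - tanhHalf (-x) ^ (2 * k + 1)) * postMinus x =
        2 * ENNReal.ofReal (1 - tanhHalf x ^ (2 * k + 2)) := fun x => by
    have h1 := hle x (2 * k + 1)
    have h2 := hge x (2 * k + 1)
    have h3 := tanhHalf_le_one x
    have h4 := neg_one_le_tanhHalf x
    have h5 : tanhHalf (-x) ^ (2 * k + 1) = -tanhHalf x ^ (2 * k + 1) := by
      rw [tanhHalf_neg, Odd.neg_pow ⟨k, rfl⟩]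
    rw [h5, postPlus, postMinus, ← ENNReal.ofReal_mul (by linarith),
      ← ENNReal.ofReal_mul (by linarith), ← ENNReal.ofReal_add
        (mul_nonneg (by linarith) (by linarith)) (mul_nonneg (by linarith) (by linarith)),
      show (2 : ENNReal) = ENNReal.ofReal 2 by simp, ← ENNReal.ofReal_mul (by norm_num)]
    congr 1
    ring
  have hm2 : Measurable fun x => ENNReal.ofReal (1 - tanhHalf x ^ (2 * k + 2)) :=
    (measurable_const.sub (measurable_tanhHalf.pow_const _)).ennreal_ofReal
  have h := ha.two_mul_lintegral hm
  rw [lintegral_congr hpt, lintegral_const_mul _ hm2] at h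
  have h' := congrArg ENNReal.toReal ((ENNReal.mul_right_inj (by norm_num) (by norm_num)).1 h)
  have hint : ∀ n, (∫⁻ x, ENNReal.ofReal (1 - tanhHalf x ^ n) ∂(a : Measure EReal)).toReal =
      1 - tanhMoment a n := fun n => by
    have hmn : Measurable fun x => 1 - tanhHalf x ^ n :=
      measurable_const.sub (measurable_tanhHalf.pow_const _)
    rw [← integral_eq_lintegral_of_nonneg_ae
      (Eventually.of_forall fun x => by simpa using hle x n) hmn.aestronglyMeasurable,
      integral_sub (integrable_const _) (integrable_tanhHalf_pow a n)]
    simp [tanhMoment]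
  rw [hint, hint] at h'
  linarith

/-- The weight is the second derivative of τ^{n+2}: as for any convex function, the power is a
positive mixture of the kinks max(τ, r), up to an affine term, here the constant n + 1. -/
theorem intervalIntegral_pow_mul_max (n : ℕ) {r : ℝ} (h0 : 0 ≤ r) (h1 : r ≤ 1) :
    ∫ τ in (0 : ℝ)..1, ((n + 2) * (n + 1) * τ ^ n) * max τ r = r ^ (n + 2) + (n + 1) := by
  have hc : Continuous fun τ : ℝ => ((n + 2 : ℝ) * (n + 1) * τ ^ n) * max τ r := by fun_prop
  rw [← intervalIntegral.integral_add_adjacent_intervals (b := r)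
    (hc.intervalIntegrable _ _) (hc.intervalIntegrable _ _)]
  have e1 : ∫ τ in (0 : ℝ)..r, ((n + 2 : ℝ) * (n + 1) * τ ^ n) * max τ r =
      ∫ τ in (0 : ℝ)..r, ((n + 2 : ℝ) * (n + 1) * r) * τ ^ n := by
    refine intervalIntegral.integral_congr fun τ hτ => ?_
    rw [Set.uIcc_of_le h0] at hτ
    simp only [max_eq_right hτ.2]
    ring
  have e2 : ∫ τ in r..1, ((n + 2 : ℝ) * (n + 1) * τ ^ n) * max τ r =
      ∫ τ in r..1, ((n + 2 : ℝ) * (n + 1)) * τ ^ (n + 1) := by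
    refine intervalIntegral.integral_congr fun τ hτ => ?_
    rw [Set.uIcc_of_le h1] at hτ
    simp only [max_eq_left hτ.1]
    ring
  rw [e1, e2, intervalIntegral.integral_const_mul, intervalIntegral.integral_const_mul,
    integral_pow, integral_pow]
  push_cast
  have : (n : ℝ) + 1 ≠ 0 := by positivity
  have : (n : ℝ) + 1 + 1 ≠ 0 := by positivity
  field_simp
  ring

theorem lintegral_pow_mul_max (n : ℕ) {r : ℝ} (h0 : 0 ≤ r) (h1 : r ≤ 1) :
    ∫⁻ τ in Set.Ioc (0 : ℝ) 1, ENNReal.ofReal ((n + 2) * (n + 1) * τ ^ n) *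
      ENNReal.ofReal (max τ r) = ENNReal.ofReal (r ^ (n + 2)) + (n + 1 : ℕ) := by
  have hc : Continuous fun τ : ℝ => ((n + 2 : ℝ) * (n + 1) * τ ^ n) * max τ r := by fun_prop
  have hnn : ∀ᵐ τ ∂(volume.restrict (Set.Ioc (0 : ℝ) 1)),
      0 ≤ ((n + 2 : ℝ) * (n + 1) * τ ^ n) * max τ r := by
    filter_upwards [ae_restrict_mem measurableSet_Ioc] with τ hτ
    have := hτ.1
    have : 0 ≤ max τ r := le_max_of_le_right h0
    positivity
  have hi : Integrable (fun τ : ℝ => ((n + 2 : ℝ) * (n + 1) * τ ^ n) * max τ r)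
      (volume.restrict (Set.Ioc (0 : ℝ) 1)) := hc.integrableOn_Ioc
  have h := ofReal_integral_eq_lintegral_ofReal hi hnn
  rw [← intervalIntegral.integral_of_le zero_le_one, intervalIntegral_pow_mul_max n h0 h1] at h
  rw [← ENNReal.ofReal_natCast, ← ENNReal.ofReal_add (by positivity) (by positivity)]
  push_cast
  rw [h]
  refine lintegral_congr_ae ?_
  filter_upwards [ae_restrict_mem measurableSet_Ioc] with τ hτ
  have := hτ.1
  rw [← ENNReal.ofReal_mul (by positivity)]

theorem lintegral_abs_tanhHalf_pow (a : ProbabilityMeasure EReal) (n : ℕ) :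
    ∫⁻ x, ENNReal.ofReal (|tanhHalf x| ^ (n + 2)) ∂(a : Measure EReal) + (n + 1 : ℕ) =
      ∫⁻ τ in Set.Ioc (0 : ℝ) 1, ENNReal.ofReal ((n + 2) * (n + 1) * τ ^ n) *
        foldProfile a τ := by
  have hm : Measurable fun p : EReal × ℝ => ENNReal.ofReal (((n : ℝ) + 2) * (n + 1) * p.2 ^ n) *
      ENNReal.ofReal (max p.2 |tanhHalf p.1|) :=
    (by fun_prop : Measurable fun p : EReal × ℝ =>
      ENNReal.ofReal (((n : ℝ) + 2) * (n + 1) * p.2 ^ n)).mul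
      (measurable_foldIntegrand.comp measurable_swap)
  calc ∫⁻ x, ENNReal.ofReal (|tanhHalf x| ^ (n + 2)) ∂(a : Measure EReal) + (n + 1 : ℕ)
      = ∫⁻ x, (ENNReal.ofReal (|tanhHalf x| ^ (n + 2)) + (n + 1 : ℕ)) ∂(a : Measure EReal) := by
        rw [lintegral_add_right _ measurable_const]
        simp
    _ = ∫⁻ x, (∫⁻ τ in Set.Ioc (0 : ℝ) 1, ENNReal.ofReal ((n + 2) * (n + 1) * τ ^ n) *
          ENNReal.ofReal (max τ |tanhHalf x|)) ∂(a : Measure EReal) :=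
        lintegral_congr fun x =>
          (lintegral_pow_mul_max n (abs_nonneg _) (abs_tanhHalf_le_one x)).symm
    _ = ∫⁻ τ in Set.Ioc (0 : ℝ) 1, ∫⁻ x, ENNReal.ofReal ((n + 2) * (n + 1) * τ ^ n) *
          ENNReal.ofReal (max τ |tanhHalf x|) ∂(a : Measure EReal) :=
        lintegral_lintegral_swap hm.aemeasurable
    _ = _ := lintegral_congr fun τ =>
        lintegral_const_mul _ (measurable_foldIntegrand.comp measurable_prodMk_left)

theorem lintegral_abs_tanhHalf_pow_ne_top (a : ProbabilityMeasure EReal) (n : ℕ) :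
    ∫⁻ x, ENNReal.ofReal (|tanhHalf x| ^ n) ∂(a : Measure EReal) ≠ ⊤ := by
  refine ne_top_of_le_ne_top (b := 1) ENNReal.one_ne_top ?_
  calc ∫⁻ x, ENNReal.ofReal (|tanhHalf x| ^ n) ∂(a : Measure EReal)
      ≤ ∫⁻ _, 1 ∂(a : Measure EReal) := lintegral_mono fun x =>
        ENNReal.ofReal_le_one.2 (pow_le_one₀ (abs_nonneg _) (abs_tanhHalf_le_one x))
    _ = 1 := by simp

/-- Integrates the comparison of fold profiles against the positive weight above; the common
constant cancels. -/
theorem ErrorLE.tanhMoment_le {a b : ProbabilityMeasure EReal} (ha : IsLDensity a)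
    (hb : IsLDensity b) (h : ErrorLE a b) (k : ℕ) :
    tanhMoment b (2 * k) ≤ tanhMoment a (2 * k) := by
  rw [errorLE_iff_foldProfile ha hb] at h
  cases k with
  | zero => simp [tanhMoment_zero]
  | succ k =>
    rw [tanhMoment_even_eq_toReal, tanhMoment_even_eq_toReal]
    refine ENNReal.toReal_mono (lintegral_abs_tanhHalf_pow_ne_top a _) ?_
    rw [mul_add, mul_one, ← ENNReal.add_le_add_iff_right (ENNReal.natCast_ne_top (2 * k + 1)),
      lintegral_abs_tanhHalf_pow, lintegral_abs_tanhHalf_pow]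
    refine lintegral_mono_ae ?_
    filter_upwards [ae_restrict_mem measurableSet_Ioc] with τ hτ
    exact mul_le_mul_right (h τ hτ.1.le) _

/-! ### The Bhattacharyya parameter -/

/-- The right side is even in x, so symmetrization turns the Bhattacharyya parameter into the mean
of √(1 - tanh²). -/
theorem exp_neg_half_mul_postPlus (x : EReal) :
    EReal.exp (-x / 2) * postPlus x = ENNReal.ofReal √(1 - tanhHalf x ^ 2) := by
  have h2 : (2 : EReal) = ((2 : ℝ) : EReal) := rfl
  induction x with
  | bot => simp
  | top =>
    rw [EReal.neg_top, h2, EReal.bot_div_of_pos_ne_top (by norm_num) (EReal.coe_ne_top 2)]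
    simp
  | coe x =>
    have hx := Real.exp_pos (x / 2)
    have h1 : Real.exp x = Real.exp (x / 2) * Real.exp (x / 2) := by
      rw [← Real.exp_add]; ring_nf
    have h3 : Real.exp (-x / 2) = (Real.exp (x / 2))⁻¹ := by
      rw [← Real.exp_neg]; ring_nf
    rw [h2, ← EReal.coe_neg, ← EReal.coe_div, EReal.exp_coe, postPlus,
      ← ENNReal.ofReal_mul (Real.exp_pos _).le, tanhHalf_coe, h3, h1]
    set u := Real.exp (x / 2)
    congr 1
    symm
    rw [Real.sqrt_eq_iff_mul_self_eq_of_pos]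
    · field_simp
      ring
    · have : 1 + (u * u - 1) / (u * u + 1) = 2 * u * u / (u * u + 1) := by field_simp; ring
      rw [this]
      positivity

theorem one_sub_tanhHalf_sq_nonneg (x : EReal) : 0 ≤ 1 - tanhHalf x ^ 2 := by
  have := (sq_le_one_iff_abs_le_one (tanhHalf x)).2 (abs_tanhHalf_le_one x)
  linarith

theorem sqrt_one_sub_tanhHalf_sq_le_one (x : EReal) : √(1 - tanhHalf x ^ 2) ≤ 1 :=
  Real.sqrt_le_one.2 (by linarith [sq_nonneg (tanhHalf x)])

theorem measurable_sqrt_one_sub_tanhHalf_sq : Measurable fun x => √(1 - tanhHalf x ^ 2) :=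
  (measurable_const.sub (measurable_tanhHalf.pow_const 2)).sqrt

theorem measurable_exp_neg_half : Measurable fun x : EReal => EReal.exp (-x / 2) := by
  simp only [div_eq_mul_inv]
  exact (measurable_neg_ereal.mul_const _).ereal_exp

theorem IsLDensity.lintegral_exp_neg_half {a : ProbabilityMeasure EReal} (ha : IsLDensity a) :
    ∫⁻ x, EReal.exp (-x / 2) ∂(a : Measure EReal) =
      ∫⁻ x, ENNReal.ofReal √(1 - tanhHalf x ^ 2) ∂(a : Measure EReal) := by
  have h := ha.two_mul_lintegral measurable_exp_neg_half
  have hpt : ∀ x, EReal.exp (-x / 2) * postPlus x + EReal.exp (- -x / 2) * postMinus x =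
      2 * ENNReal.ofReal √(1 - tanhHalf x ^ 2) := fun x => by
    rw [← postPlus_neg, exp_neg_half_mul_postPlus, exp_neg_half_mul_postPlus, tanhHalf_neg,
      neg_sq, two_mul]
  rw [lintegral_congr hpt,
    lintegral_const_mul _ measurable_sqrt_one_sub_tanhHalf_sq.ennreal_ofReal] at h
  exact (ENNReal.mul_right_inj (by norm_num) (by norm_num)).1 h

theorem IsLDensity.bhattacharyya_eq {a : ProbabilityMeasure EReal} (ha : IsLDensity a) :
    bhattacharyya a = ∫ x, √(1 - tanhHalf x ^ 2) ∂(a : Measure EReal) := by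
  rw [bhattacharyya, ha.lintegral_exp_neg_half, integral_eq_lintegral_of_nonneg_ae
    (Eventually.of_forall fun x => Real.sqrt_nonneg _)
    measurable_sqrt_one_sub_tanhHalf_sq.aestronglyMeasurable]

theorem IsLDensity.lintegral_exp_neg_half_ne_top {a : ProbabilityMeasure EReal}
    (ha : IsLDensity a) : ∫⁻ x, EReal.exp (-x / 2) ∂(a : Measure EReal) ≠ ⊤ := by
  rw [ha.lintegral_exp_neg_half]
  refine ne_top_of_le_ne_top (b := 1) ENNReal.one_ne_top ?_
  calc ∫⁻ x, ENNReal.ofReal √(1 - tanhHalf x ^ 2) ∂(a : Measure EReal)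
      ≤ ∫⁻ _, 1 ∂(a : Measure EReal) := lintegral_mono fun x =>
        ENNReal.ofReal_le_one.2 (sqrt_one_sub_tanhHalf_sq_le_one x)
    _ = 1 := by simp

theorem bhattacharyya_nonneg (a : ProbabilityMeasure EReal) : 0 ≤ bhattacharyya a :=
  ENNReal.toReal_nonneg

theorem integrable_sqrt_one_sub_tanhHalf_sq (a : ProbabilityMeasure EReal) :
    Integrable (fun x => √(1 - tanhHalf x ^ 2)) (a : Measure EReal) :=
  integrable_of_abs_le a measurable_sqrt_one_sub_tanhHalf_sq (C := 1) fun x => by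
    rw [abs_of_nonneg (Real.sqrt_nonneg _)]
    exact sqrt_one_sub_tanhHalf_sq_le_one x

theorem IsLDensity.bhattacharyya_le_one {a : ProbabilityMeasure EReal} (ha : IsLDensity a) :
    bhattacharyya a ≤ 1 := by
  rw [ha.bhattacharyya_eq]
  calc ∫ x, √(1 - tanhHalf x ^ 2) ∂(a : Measure EReal) ≤ ∫ _, (1 : ℝ) ∂(a : Measure EReal) :=
        integral_mono (integrable_sqrt_one_sub_tanhHalf_sq a) (integrable_const _)
          sqrt_one_sub_tanhHalf_sq_le_one
    _ = 1 := by simp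

theorem IsLDensity.tanhMoment_two_le {a : ProbabilityMeasure EReal} (ha : IsLDensity a) :
    tanhMoment a 2 ≤ 1 - bhattacharyya a ^ 2 := by
  set B := bhattacharyya a
  have hi := integrable_sqrt_one_sub_tanhHalf_sq a
  -- Jensen's inequality for the square, through the tangent line 2Bs - B² ≤ s² with s = √(1 -
  -- tanh²), whose mean is B.
  have h : ∫ x, (2 * B * √(1 - tanhHalf x ^ 2) - B ^ 2) ∂(a : Measure EReal) ≤
      ∫ x, (1 - tanhHalf x ^ 2) ∂(a : Measure EReal) := by
    refine integral_mono ((hi.const_mul _).sub (integrable_const _))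
      ((integrable_const _).sub (integrable_tanhHalf_pow a 2)) fun x => ?_
    nlinarith [sq_nonneg (√(1 - tanhHalf x ^ 2) - B),
      Real.sq_sqrt (one_sub_tanhHalf_sq_nonneg x)]
  rw [integral_sub (hi.const_mul _) (integrable_const _), integral_const_mul,
    ← ha.bhattacharyya_eq, integral_sub (integrable_const _) (integrable_tanhHalf_pow a 2)] at h
  simp only [integral_const, probReal_univ, smul_eq_mul, one_mul] at h
  change 2 * B * B - B ^ 2 ≤ 1 - tanhMoment a 2 at h
  linarith

theorem IsLDensity.one_sub_bhattacharyya_sq_nonneg {a : ProbabilityMeasure EReal}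
    (ha : IsLDensity a) : 0 ≤ 1 - bhattacharyya a ^ 2 := by
  have := pow_le_one₀ (n := 2) (bhattacharyya_nonneg a) ha.bhattacharyya_le_one
  linarith

theorem IsLDensity.bhattacharyya_varConv {a b : ProbabilityMeasure EReal} (ha : IsLDensity a)
    (hb : IsLDensity b) :
    bhattacharyya (_root_.varConv a b) = bhattacharyya a * bhattacharyya b := by
  have h2 : (2 : EReal) = ((2 : ℝ) : EReal) := rfl
  rw [bhattacharyya, lintegral_varConv a b measurable_exp_neg_half, bhattacharyya, bhattacharyya,
    ← ENNReal.toReal_mul, ← lintegral_mul_const _ measurable_exp_neg_half]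
  congr 1
  refine lintegral_congr_ae ?_
  filter_upwards [ha.ae_ne_bot] with x hx
  rw [← lintegral_const_mul _ measurable_exp_neg_half]
  refine lintegral_congr_ae ?_
  filter_upwards [hb.ae_ne_bot] with y hy
  rw [← EReal.exp_add, EReal.neg_add_of_ne_bot hx hy]
  congr 1
  rw [h2]
  simp only [div_eq_mul_inv, ← EReal.coe_inv]
  exact EReal.right_distrib_of_nonneg_of_ne_top (by exact_mod_cast (by norm_num))
    (EReal.coe_ne_top _) _ _

theorem DegreeDistribution.bhattacharyya_mix (p : DegreeDistribution)
    {g : ℕ → ProbabilityMeasure EReal} (hg : ∀ n, IsLDensity (g n)) :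
    bhattacharyya (p.mix g) = ∑ n ∈ Finset.range (p.poly.natDegree + 1),
      p.poly.coeff n * bhattacharyya (g n) := by
  rw [bhattacharyya, p.lintegral_mix, ENNReal.toReal_sum fun n _ =>
    ENNReal.mul_ne_top ENNReal.ofReal_ne_top (hg n).lintegral_exp_neg_half_ne_top]
  refine Finset.sum_congr rfl fun n _ => ?_
  rw [ENNReal.toReal_mul, ENNReal.toReal_ofReal (p.coeff_nonneg n), bhattacharyya]

theorem bhattacharyya_unitMass_zero : bhattacharyya (unitMass 0) = 1 := by
  simp [bhattacharyya, lintegral_unitMass]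

theorem IsLDensity.bhattacharyya_varPow {a : ProbabilityMeasure EReal} (ha : IsLDensity a)
    (n : ℕ) : bhattacharyya (_root_.varPow a n) = bhattacharyya a ^ n := by
  induction n with
  | zero => rw [pow_zero, _root_.varPow, bhattacharyya_unitMass_zero]
  | succ n ih => rw [_root_.varPow, ha.bhattacharyya_varConv (ha.varPow n), ih, pow_succ']

theorem IsLDensity.bhattacharyya_densityEvolution (lam rho : DegreeDistribution)
    {c a : ProbabilityMeasure EReal} (hc : IsLDensity c) (ha : IsLDensity a) :
    bhattacharyya (_root_.densityEvolution lam rho c a) =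
      bhattacharyya c * lam.poly.eval (bhattacharyya (rho.mix (_root_.checkPow a))) := by
  have h := rho.isLDensity_mix ha.checkPow
  rw [_root_.densityEvolution, hc.bhattacharyya_varConv (lam.isLDensity_mix h.varPow),
    lam.bhattacharyya_mix h.varPow, Polynomial.eval_eq_sum_range]
  simp only [h.bhattacharyya_varPow]

theorem exists_hasSum_one_sub_bhattacharyya : ∃ c : ℕ → ℝ, (∀ k, 0 < c k) ∧
    ∀ a : ProbabilityMeasure EReal, IsLDensity a →
      HasSum (fun k => c k * tanhMoment a (2 * (k + 1))) (1 - bhattacharyya a) := by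
  obtain ⟨c, hc, hs⟩ := exists_hasSum_one_sub_sqrt
  refine ⟨c, hc, fun a ha => ?_⟩
  have hsum : Summable c := by simpa using (hs 1 zero_le_one le_rfl).summable
  have h := hasSum_integral_of_dominated_convergence (μ := (a : Measure EReal))
    (F := fun k x => c k * tanhHalf x ^ (2 * (k + 1))) (f := fun x => 1 - √(1 - tanhHalf x ^ 2))
    (fun k _ => c k) (fun k => ((measurable_tanhHalf.pow_const _).const_mul _).aestronglyMeasurable)
    (fun k => Eventually.of_forall fun x => by
      rw [norm_mul, Real.norm_of_nonneg (hc k).le, Real.norm_eq_abs]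
      exact mul_le_of_le_one_right (hc k).le (abs_tanhHalf_pow_le_one x _))
    (Eventually.of_forall fun _ => hsum) (integrable_const _)
    (Eventually.of_forall fun x => by
      have := hs (tanhHalf x ^ 2) (sq_nonneg _) (by linarith [one_sub_tanhHalf_sq_nonneg x])
      simpa only [← pow_mul] using this)
  rw [integral_sub (integrable_const _) (integrable_sqrt_one_sub_tanhHalf_sq a),
    ← ha.bhattacharyya_eq] at h
  simp only [integral_const_mul, integral_const, probReal_univ, smul_eq_mul, one_mul] at h
  exact h

/-! ### Contraction of density evolution -/

/-- The even moments of `tanh (X / 2)` are at most as large under `b` as under `a`. -/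
def EvenMomentLE (b a : ProbabilityMeasure EReal) : Prop :=
  ∀ k, tanhMoment b (2 * k) ≤ tanhMoment a (2 * k)

theorem EvenMomentLE.checkPow {a b : ProbabilityMeasure EReal} (h : EvenMomentLE b a) (n : ℕ) :
    EvenMomentLE (checkPow b n) (checkPow a n) := fun k => by
  rw [tanhMoment_checkPow, tanhMoment_checkPow]
  exact pow_le_pow_left₀ (tanhMoment_even_nonneg b k) (h k) n

theorem EvenMomentLE.bhattacharyya_le {a b : ProbabilityMeasure EReal} (ha : IsLDensity a)
    (hb : IsLDensity b) (h : EvenMomentLE b a) : bhattacharyya a ≤ bhattacharyya b := by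
  obtain ⟨c, hc, hs⟩ := exists_hasSum_one_sub_bhattacharyya
  have := hasSum_le (fun k => mul_le_mul_of_nonneg_left (h (k + 1)) (hc k).le) (hs b hb) (hs a ha)
  linarith

/-- Both sides are series in the even moments, which become n-th powers under `checkPow`. Termwise,
the mean value bound has slope n m^{n-1}, where m is a moment of `a` and so at most 1 - B(a)². -/
theorem EvenMomentLE.bhattacharyya_checkPow_sub_le {a b : ProbabilityMeasure EReal}
    (ha : IsLDensity a) (hb : IsLDensity b) (h : EvenMomentLE b a) (n : ℕ) :
    bhattacharyya (_root_.checkPow b n) - bhattacharyya (_root_.checkPow a n) ≤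
      n * (1 - bhattacharyya a ^ 2) ^ (n - 1) * (bhattacharyya b - bhattacharyya a) := by
  obtain ⟨c, hc, hs⟩ := exists_hasSum_one_sub_bhattacharyya
  have h1 := (hs _ (ha.checkPow n)).sub (hs _ (hb.checkPow n))
  have h2 := ((hs a ha).sub (hs b hb)).mul_left (n * (1 - bhattacharyya a ^ 2) ^ (n - 1))
  rw [sub_sub_sub_cancel_left] at h1 h2
  refine hasSum_le (fun k => ?_) h1 h2
  have hb0 := tanhMoment_even_nonneg b (k + 1)
  have hle := h (k + 1)
  have hM : tanhMoment a (2 * (k + 1)) ≤ 1 - bhattacharyya a ^ 2 :=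
    (tanhMoment_even_le_two a k).trans ha.tanhMoment_two_le
  rw [tanhMoment_checkPow, tanhMoment_checkPow, ← mul_sub, ← mul_sub, mul_left_comm]
  refine mul_le_mul_of_nonneg_left ((pow_sub_pow_le hb0 hle n).trans ?_) (hc k).le
  have := pow_le_pow_left₀ (hb0.trans hle) hM (n - 1)
  have : 0 ≤ tanhMoment a (2 * (k + 1)) - tanhMoment b (2 * (k + 1)) := sub_nonneg.2 hle
  gcongr

/-- The three factors come from the three operations: ρ' from the check nodes, λ'(1) from the mean
value bound on [0, 1], and B(c) from multiplicativity at the variable node. -/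
theorem EvenMomentLE.bhattacharyya_densityEvolution_sub_le (lam rho : DegreeDistribution)
    {c a b : ProbabilityMeasure EReal} (hc : IsLDensity c) (ha : IsLDensity a)
    (hb : IsLDensity b) (h : EvenMomentLE b a) :
    bhattacharyya (densityEvolution lam rho c b) - bhattacharyya (densityEvolution lam rho c a) ≤
      uniquenessFactor lam rho c a * (bhattacharyya b - bhattacharyya a) := by
  have hmixa := rho.isLDensity_mix ha.checkPow
  have hmixb := rho.isLDensity_mix hb.checkPow
  have ea := rho.bhattacharyya_mix ha.checkPow
  have eb := rho.bhattacharyya_mix hb.checkPow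
  have hle : bhattacharyya (rho.mix (_root_.checkPow a)) ≤
      bhattacharyya (rho.mix (_root_.checkPow b)) := by
    rw [ea, eb]
    exact Finset.sum_le_sum fun n _ => mul_le_mul_of_nonneg_left
      ((h.checkPow n).bhattacharyya_le (ha.checkPow n) (hb.checkPow n)) (rho.coeff_nonneg n)
  have hrho : bhattacharyya (rho.mix (_root_.checkPow b)) -
      bhattacharyya (rho.mix (_root_.checkPow a)) ≤
        rho.poly.derivative.eval (1 - bhattacharyya a ^ 2) *
          (bhattacharyya b - bhattacharyya a) := by
    rw [ea, eb, ← Finset.sum_sub_distrib, rho.eval_derivative, Finset.sum_mul]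
    refine Finset.sum_le_sum fun n _ => ?_
    rw [← mul_sub, mul_assoc]
    exact mul_le_mul_of_nonneg_left (h.bhattacharyya_checkPow_sub_le ha hb n) (rho.coeff_nonneg n)
  have hlam := lam.eval_sub_le (bhattacharyya_nonneg _) hle hmixb.bhattacharyya_le_one
  have hlam' := lam.eval_derivative_nonneg zero_le_one
  rw [hc.bhattacharyya_densityEvolution lam rho hb, hc.bhattacharyya_densityEvolution lam rho ha,
    ← mul_sub, uniquenessFactor, mul_assoc, mul_assoc]
  refine mul_le_mul_of_nonneg_left (hlam.trans ?_) (bhattacharyya_nonneg c)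
  exact mul_le_mul_of_nonneg_left hrho hlam'

theorem uniquenessFactor_nonneg (lam rho : DegreeDistribution) (c : ProbabilityMeasure EReal)
    {a : ProbabilityMeasure EReal} (ha : IsLDensity a) : 0 ≤ uniquenessFactor lam rho c a :=
  mul_nonneg (mul_nonneg (bhattacharyya_nonneg c) (lam.eval_derivative_nonneg zero_le_one))
    (rho.eval_derivative_nonneg ha.one_sub_bhattacharyya_sq_nonneg)

/-! ### Weak convergence from moments -/

theorem integral_eval_tanhHalf (a : ProbabilityMeasure EReal) (p : Polynomial ℝ) :
    ∫ x, p.eval (tanhHalf x) ∂(a : Measure EReal) =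
      ∑ n ∈ Finset.range (p.natDegree + 1), p.coeff n * tanhMoment a n := by
  simp only [Polynomial.eval_eq_sum_range]
  rw [integral_finsetSum _ fun n _ => (integrable_tanhHalf_pow a n).const_mul _]
  simp only [integral_const_mul, tanhMoment]

/-- In the coordinate tanh(x/2) a bounded continuous test function becomes continuous on [-1, 1], so
Weierstrass approximation reduces to polynomials. -/
theorem tendsto_of_tendsto_tanhMoment {x : ℕ → ProbabilityMeasure EReal}
    {f : ProbabilityMeasure EReal}
    (h : ∀ n, Tendsto (fun l => tanhMoment (x l) n) atTop (𝓝 (tanhMoment f n))) :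
    Tendsto x atTop (𝓝 f) := by
  rw [ProbabilityMeasure.tendsto_iff_forall_integral_tendsto]
  intro g
  rw [Metric.tendsto_atTop]
  intro ε hε
  obtain ⟨p, hp⟩ := exists_polynomial_near_of_continuousOn (-1) 1 (fun y => g (twoArtanh y))
    (g.continuous.comp continuous_twoArtanh).continuousOn (ε / 3) (by positivity)
  have happrox : ∀ a : ProbabilityMeasure EReal,
      |∫ x, p.eval (tanhHalf x) ∂(a : Measure EReal) - ∫ x, g x ∂(a : Measure EReal)| ≤ ε / 3 :=
    fun a => by
    have hpi : Integrable (fun x => p.eval (tanhHalf x)) (a : Measure EReal) := by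
      simp only [Polynomial.eval_eq_sum_range]
      exact integrable_finsetSum _ fun n _ => (integrable_tanhHalf_pow a n).const_mul _
    rw [← integral_sub hpi (g.integrable _), ← Real.norm_eq_abs]
    refine (norm_integral_le_of_norm_le_const (C := ε / 3)
      (Eventually.of_forall fun x => ?_)).trans (by simp)
    have := hp (tanhHalf x) ⟨neg_one_le_tanhHalf x, tanhHalf_le_one x⟩
    simp only [twoArtanh_tanhHalf] at this
    exact this.le
  have hpt : Tendsto (fun l => ∫ y, p.eval (tanhHalf y) ∂(x l : Measure EReal)) atTop
      (𝓝 (∫ y, p.eval (tanhHalf y) ∂(f : Measure EReal))) := by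
    simp only [integral_eval_tanhHalf]
    exact tendsto_finsetSum _ fun n _ => (h n).const_mul _
  obtain ⟨N, hN⟩ := Metric.tendsto_atTop.1 hpt (ε / 3) (by positivity)
  refine ⟨N, fun l hl => ?_⟩
  have h1 := abs_le.1 (happrox (x l))
  have h2 := abs_le.1 (happrox f)
  have h3 := hN l hl
  rw [Real.dist_eq, abs_lt] at h3 ⊢
  constructor <;> linarith [h1.1, h1.2, h2.1, h2.2, h3.1, h3.2]

/-! ### Density evolution from the useless density -/

theorem isLDensity_iterate (lam rho : DegreeDistribution) {c : ProbabilityMeasure EReal}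
    (hc : IsLDensity c) (l : ℕ) :
    IsLDensity ((densityEvolution lam rho c)^[l] (unitMass 0)) := by
  induction l with
  | zero => exact isLDensity_unitMass_zero
  | succ l ih =>
    rw [Function.iterate_succ_apply']
    exact hc.densityEvolution lam rho ih

theorem IsFixedPointDensity.errorLE_iterate {lam rho : DegreeDistribution}
    {c f : ProbabilityMeasure EReal} (hc : IsLDensity c) (hf : IsFixedPointDensity lam rho c f)
    (l : ℕ) : ErrorLE f ((densityEvolution lam rho c)^[l] (unitMass 0)) := by
  induction l with
  | zero => exact errorLE_unitMass_zero hf.isLDensity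
  | succ l ih =>
    rw [Function.iterate_succ_apply']
    have h := ErrorLE.densityEvolution lam rho hc hc hf.isLDensity
      (isLDensity_iterate lam rho hc l) (ErrorLE.refl c) ih
    rwa [hf.fixed] at h

theorem errorLE_iterate_of_errorLE (lam rho : DegreeDistribution)
    {c c' : ProbabilityMeasure EReal} (hc : IsLDensity c) (hc' : IsLDensity c')
    (h : ErrorLE c c') (l : ℕ) : ErrorLE ((densityEvolution lam rho c)^[l] (unitMass 0))
      ((densityEvolution lam rho c')^[l] (unitMass 0)) := by
  induction l with
  | zero => exact ErrorLE.refl _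
  | succ l ih =>
    rw [Function.iterate_succ_apply', Function.iterate_succ_apply']
    exact ErrorLE.densityEvolution lam rho hc hc' (isLDensity_iterate lam rho hc l)
      (isLDensity_iterate lam rho hc' l) h ih

theorem IsFixedPointDensity.tendsto_bhattacharyya {lam rho : DegreeDistribution}
    {c f : ProbabilityMeasure EReal} (hc : IsLDensity c) (hf : IsFixedPointDensity lam rho c f)
    (hq : uniquenessFactor lam rho c f < 1) :
    Tendsto (fun l => bhattacharyya ((densityEvolution lam rho c)^[l] (unitMass 0))) atTop
      (𝓝 (bhattacharyya f)) := by
  set x : ℕ → ProbabilityMeasure EReal := fun l => (densityEvolution lam rho c)^[l] (unitMass 0)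
    with hx
  set q := uniquenessFactor lam rho c f
  have hq0 : 0 ≤ q := uniquenessFactor_nonneg lam rho c hf.isLDensity
  have hL : ∀ l, IsLDensity (x l) := isLDensity_iterate lam rho hc
  have hM : ∀ l, EvenMomentLE (x l) f := fun l =>
    (hf.errorLE_iterate hc l).tanhMoment_le hf.isLDensity (hL l)
  have hnn : ∀ l, bhattacharyya f ≤ bhattacharyya (x l) := fun l =>
    (hM l).bhattacharyya_le hf.isLDensity (hL l)
  -- The initial gap is at most 1 because B lies in [0, 1]; each step contracts it by q, since f is
  -- fixed.
  have hbound : ∀ l, bhattacharyya (x l) - bhattacharyya f ≤ q ^ l * 1 := fun l => by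
    induction l with
    | zero =>
      have := (hL 0).bhattacharyya_le_one
      have := bhattacharyya_nonneg f
      linarith
    | succ l ih =>
      have h := (hM l).bhattacharyya_densityEvolution_sub_le lam rho hc hf.isLDensity (hL l)
      rw [hf.fixed] at h
      have hstep : x (l + 1) = densityEvolution lam rho c (x l) :=
        Function.iterate_succ_apply' _ _ _
      rw [hstep, pow_succ', mul_assoc]
      exact h.trans (mul_le_mul_of_nonneg_left ih hq0)
  have h0 : Tendsto (fun l => bhattacharyya f + q ^ l * 1) atTop (𝓝 (bhattacharyya f)) := by
    simpa using (tendsto_pow_atTop_nhds_zero_of_lt_one hq0 hq).const_add (bhattacharyya f)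
  exact tendsto_of_tendsto_of_tendsto_of_le_of_le tendsto_const_nhds h0 hnn
    fun l => by linarith [hbound l]

theorem IsFixedPointDensity.tendsto_tanhMoment_even {lam rho : DegreeDistribution}
    {c f : ProbabilityMeasure EReal} (hc : IsLDensity c) (hf : IsFixedPointDensity lam rho c f)
    (hq : uniquenessFactor lam rho c f < 1) (k : ℕ) :
    Tendsto (fun l => tanhMoment ((densityEvolution lam rho c)^[l] (unitMass 0)) (2 * k)) atTop
      (𝓝 (tanhMoment f (2 * k))) := by
  cases k with
  | zero => simp [tanhMoment_zero]
  | succ k =>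
    obtain ⟨w, hw, hs⟩ := exists_hasSum_one_sub_bhattacharyya
    set x : ℕ → ProbabilityMeasure EReal := fun l => (densityEvolution lam rho c)^[l] (unitMass 0)
    have hL : ∀ l, IsLDensity (x l) := isLDensity_iterate lam rho hc
    have hM : ∀ l, EvenMomentLE (x l) f := fun l =>
      (hf.errorLE_iterate hc l).tanhMoment_le hf.isLDensity (hL l)
    -- The gap in B is a series of nonnegative moment gaps, so it dominates its k-th term; strict
    -- positivity of `w k` permits the division.
    have hlow : ∀ l, tanhMoment f (2 * (k + 1)) - (bhattacharyya (x l) - bhattacharyya f) / w k ≤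
        tanhMoment (x l) (2 * (k + 1)) := fun l => by
      have h1 := (hs f hf.isLDensity).sub (hs _ (hL l))
      have h2 := le_hasSum h1 k fun j _ => by
        rw [← mul_sub]
        exact mul_nonneg (hw j).le (sub_nonneg.2 (hM l (j + 1)))
      rw [← mul_sub, sub_sub_sub_cancel_left] at h2
      have h3 := (le_div_iff₀' (hw k)).2 h2
      linarith
    have h0 : Tendsto (fun l => tanhMoment f (2 * (k + 1)) -
        (bhattacharyya (x l) - bhattacharyya f) / w k) atTop (𝓝 (tanhMoment f (2 * (k + 1)))) := by
      simpa using (((hf.tendsto_bhattacharyya hc hq).sub_const (bhattacharyya f)).div_const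
        (w k)).const_sub (tanhMoment f (2 * (k + 1)))
    exact tendsto_of_tendsto_of_tendsto_of_le_of_le h0 tendsto_const_nhds hlow
      fun l => hM l (k + 1)

/-- A fixed point density at which density evolution contracts is the BP fixed point. -/
theorem IsFixedPointDensity.isBPFixedPoint {lam rho : DegreeDistribution}
    {c f : ProbabilityMeasure EReal} (hc : IsLDensity c) (hf : IsFixedPointDensity lam rho c f)
    (hq : uniquenessFactor lam rho c f < 1) : IsBPFixedPoint lam rho c f := by
  refine tendsto_of_tendsto_tanhMoment fun n => ?_
  rcases Nat.even_or_odd' n with ⟨k, rfl | rfl⟩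
  · exact hf.tendsto_tanhMoment_even hc hq k
  · simp only [(isLDensity_iterate lam rho hc _).tanhMoment_odd, hf.isLDensity.tanhMoment_odd]
    exact hf.tendsto_tanhMoment_even hc hq (k + 1)

/-- Fixed point densities at which density evolution contracts depend on the channel in a
monotone and Lipschitz way. -/
theorem IsFixedPointDensity.bhattacharyya_sub_le {lam rho : DegreeDistribution}
    {c c' f f' : ProbabilityMeasure EReal} (hc : IsLDensity c) (hc' : IsLDensity c')
    (h : ErrorLE c c') (hf : IsFixedPointDensity lam rho c f)
    (hf' : IsFixedPointDensity lam rho c' f') {δ : ℝ} (hδ : 0 < δ)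
    (hq : uniquenessFactor lam rho c f ≤ 1 - δ) (hq' : uniquenessFactor lam rho c' f' ≤ 1 - δ) :
    |bhattacharyya f - bhattacharyya f'| ≤ 1 / δ * |bhattacharyya c - bhattacharyya c'| := by
  -- Both densities are limits of iterates from Δ₀, and those iterates are ordered at every step.
  have hM : EvenMomentLE f' f := fun k =>
    le_of_tendsto_of_tendsto' (hf'.tendsto_tanhMoment_even hc' (by linarith) k)
      (hf.tendsto_tanhMoment_even hc (by linarith) k) fun l =>
        (errorLE_iterate_of_errorLE lam rho hc hc' h l).tanhMoment_le
          (isLDensity_iterate lam rho hc l) (isLDensity_iterate lam rho hc' l) k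
  have hB := hM.bhattacharyya_le hf.isLDensity hf'.isLDensity
  have hBc : bhattacharyya c ≤ bhattacharyya c' :=
    EvenMomentLE.bhattacharyya_le hc hc' (h.tanhMoment_le hc hc')
  have h1 := hM.bhattacharyya_densityEvolution_sub_le lam rho hc hf.isLDensity hf'.isLDensity
  have h2 := hc.bhattacharyya_densityEvolution lam rho hf'.isLDensity
  have h3 := hc'.bhattacharyya_densityEvolution lam rho hf'.isLDensity
  rw [hf.fixed, h2] at h1
  rw [hf'.fixed] at h3
  have h4 := lam.eval_le_one (bhattacharyya_nonneg (rho.mix (_root_.checkPow f')))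
    (rho.isLDensity_mix hf'.isLDensity.checkPow).bhattacharyya_le_one
  have h5 := mul_le_mul_of_nonneg_right hq (sub_nonneg.2 hB)
  have h6 := mul_le_mul_of_nonneg_left h4 (sub_nonneg.2 hBc)
  rw [abs_sub_comm, abs_of_nonneg (sub_nonneg.2 hB), abs_sub_comm (bhattacharyya c),
    abs_of_nonneg (sub_nonneg.2 hBc), one_div, ← div_eq_inv_mul, le_div_iff₀ hδ]
  -- With y = B(ρ(f')), B(f') - B(f) = (B(c') - B(c)) λ(y) + (B(T_c f') - B(T_c f)). Here λ(y) ≤ 1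
  -- and the last bracket is at most (1 - δ)(B(f') - B(f)), which is where 1/δ comes from.
  nlinarith [h1, h3, h5, h6]

end

theorem mainTheorem11 (lam rho : DegreeDistribution) :
    (∀ (I : Set ℝ) (c : ℝ → ProbabilityMeasure EReal), IsDegradedFamily I c → ∀ h ∈ I,
      (∀ f f' : ProbabilityMeasure EReal,
        IsFixedPointDensity lam rho (c h) f → uniquenessFactor lam rho (c h) f < 1 →
        IsFixedPointDensity lam rho (c h) f' → uniquenessFactor lam rho (c h) f' < 1 →
        f = f') ∧
      (∀ f : ProbabilityMeasure EReal,
        IsFixedPointDensity lam rho (c h) f → uniquenessFactor lam rho (c h) f < 1 →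
        IsBPFixedPoint lam rho (c h) f)) ∧
    (∀ δ : ℝ, 0 < δ → ∃ C : ℝ,
      ∀ (I : Set ℝ) (c : ℝ → ProbabilityMeasure EReal), IsDegradedFamily I c →
      ∀ h₁ ∈ I, ∀ h₂ ∈ I, ∀ f₁ f₂ : ProbabilityMeasure EReal,
        IsFixedPointDensity lam rho (c h₁) f₁ → uniquenessFactor lam rho (c h₁) f₁ ≤ 1 - δ →
        IsFixedPointDensity lam rho (c h₂) f₂ → uniquenessFactor lam rho (c h₂) f₂ ≤ 1 - δ →
        |bhattacharyya f₁ - bhattacharyya f₂|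
          ≤ C * |bhattacharyya (c h₁) - bhattacharyya (c h₂)|) := by
  refine ⟨fun I c hI h hh => ?_, fun δ hδ => ⟨1 / δ, ?_⟩⟩
  · have hc := hI.isLDensity h hh
    exact ⟨fun f f' hf hq hf' hq' => tendsto_nhds_unique (hf.isBPFixedPoint hc hq)
      (hf'.isBPFixedPoint hc hq'), fun f hf hq => hf.isBPFixedPoint hc hq⟩
  · intro I c hI h₁ hh₁ h₂ hh₂ f₁ f₂ hf₁ hq₁ hf₂ hq₂
    have hc₁ := hI.isLDensity h₁ hh₁
    have hc₂ := hI.isLDensity h₂ hh₂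
    rcases le_total h₁ h₂ with hle | hle
    · exact hf₁.bhattacharyya_sub_le hc₁ hc₂
        ((hI.degraded h₁ hh₁ h₂ hh₂ hle).errorLE hc₁ hc₂) hf₂ hδ hq₁ hq₂
    · rw [abs_sub_comm, abs_sub_comm (bhattacharyya (c h₁))]
      exact hf₂.bhattacharyya_sub_le hc₂ hc₁
        ((hI.degraded h₂ hh₂ h₁ hh₁ hle).errorLE hc₂ hc₁) hf₁ hδ hq₂ hq₁
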